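/- Let $M$ be a compact smooth $n$-dimensional Riemannian manifold without boundary, let $\mu$ be a smooth volume on $M$ normalized to a probability measure (a smooth positive density in every chart), and let $f:M\to M$ be a $C^r$ diffeomorphism, $1\le r\le\infty$, preserving $\mu$. Let $W$ be a $k$-dimensional foliation of $M$ ($0\le k\le n$) with $C^1$ leaves and continuous tangent distribution $TW$, invariant under $f$, that is, $f(W(x))=W(f(x))$ for the leaf $W(x)$ through every $x\in M$. For $r>0$ let $W_r(x)$ be the disk of radius $r$ about $x$ in the leaf $W(x)$, with respect to the distance inside the leaf, let $\mathrm{Vol}$ be the $k$-dimensional Riemannian volume on leaves, and put $$\chi(x,r)=\limsup_{i\to\infty}\frac1i\ln\mathrm{Vol}\big(f^i(W_r(x))\big),\qquad \chi(r)=\sup_{x\in M}\chi(x,r).$$ Let $\mathrm{Jac}_x(f^j)=\|\Lambda^kD_xf^j|_{\Lambda^kT_xW}\|$ be the leafwise Jacobian, and put $$\Lambda_W(x)=\lim_{j\to\infty}\frac1j\log\mathrm{Jac}_x(f^j),\qquad \Lambda_W=\int_M\Lambda_W(x)\,d\mu(x).$$ Assume that $W$ is absolutely continuous: every $p\in M$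 lies in a foliation box and has a neighbourhood $U$ such that for any two smooth $(n-k)$-dimensional disks $D_1,D_2\subset U$ in the box, transverse to $W$ and meeting each plaque of the box at most once, the holonomy along plaques from $D_1$ to $D_2$ (where defined) maps sets of measure zero in $D_1$ to sets of measure zero in $D_2$. Then the limit $\Lambda_W(x)$ exists for $\mu$-almost every $x$, the functions $\Lambda_W(\cdot)$ and $\log\mathrm{Jac}_{\cdot}(f)$ are $\mu$-integrable, $\Lambda_W=\int_M\log\mathrm{Jac}_x(f)\,d\mu(x)$, and for every $r>0$ $$\Lambda_W\le\chi(r).$$ -/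

import Mathlib

open Set Filter Topology MeasureTheory Manifold Bundle
open scoped ENNReal ContDiff

noncomputable section

/-- A `k`-dimensional foliation, with `C^1` leaves and continuous tangent distribution, of an
`n`-dimensional manifold `M`, presented by foliation boxes. The box centered at `p` is a
homeomorphism of `ℝ^k × ℝ^(n-k)` onto an open neighbourhood of `p`; its plaques are the images of
the slices `ℝ^k × {y}`. -/
structure Foliation (n k : ℕ) (M : Type*) [TopologicalSpace M]
    [ChartedSpace (EuclideanSpace ℝ (Fin n)) M] [IsManifold (𝓡 n) ∞ M] where
  /-- The foliation box centered at a point. -/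
  box : M → EuclideanSpace ℝ (Fin k) × EuclideanSpace ℝ (Fin (n - k)) → M
  box_zero : ∀ p, box p (0, 0) = p
  isOpenEmbedding_box : ∀ p, IsOpenEmbedding (box p)
  /-- Compatibility: through a common point, the plaque of one box is locally contained in the
  plaque of the other one (so the transition maps have the form `(x, y) ↦ (g (x, y), h y)`
  locally). -/
  compatible : ∀ p p' x y x' y', box p (x, y) = box p' (x', y') →
    ∀ᶠ u in 𝓝 x, ∃ u', box p (u, y) = box p' (u', y')
  /-- The plaques are `C^1` ... -/
  contMDiff_plaque : ∀ p y, ContMDiff (𝓡 k) (𝓡 n) 1 (fun x => box p (x, y))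
  /-- ... immersed ... -/
  injective_mfderiv_plaque : ∀ p x y,
    Function.Injective (mfderiv (𝓡 k) (𝓡 n) (fun u => box p (u, y)) x)
  /-- ... and their tangent planes vary continuously in the box. -/
  continuous_mfderiv_plaque : ∀ p (w : EuclideanSpace ℝ (Fin k)),
    Continuous (fun z : EuclideanSpace ℝ (Fin k) × EuclideanSpace ℝ (Fin (n - k)) =>
      (⟨box p (z.1, z.2), mfderiv (𝓡 k) (𝓡 n) (fun u => box p (u, z.2)) z.1 w⟩ :
        TangentBundle (𝓡 n) M))

namespace Foliation

variable {n k : ℕ} {M : Type*} [TopologicalSpace M]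
  [ChartedSpace (EuclideanSpace ℝ (Fin n)) M] [IsManifold (𝓡 n) ∞ M]

/-- The points `a` and `b` lie on the same plaque of the box centered at `p`. -/
def SamePlaqueIn (W : Foliation n k M) (p a b : M) : Prop :=
  ∃ x x' y, W.box p (x, y) = a ∧ W.box p (x', y) = b

/-- The leaf through `x`: all points that can be joined to `x` by a finite chain of plaques. -/
def leaf (W : Foliation n k M) (x : M) : Set M :=
  {y | Relation.EqvGen (fun a b => ∃ p, W.SamePlaqueIn p a b) x y}

/-- The foliation is invariant under `f`: the map `f` sends leaves onto leaves. -/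
def IsInvariant (W : Foliation n k M) (f : M → M) : Prop :=
  ∀ x, f '' W.leaf x = W.leaf (f x)

/-- The derivative at `x` of the parametrization `u ↦ box p (u, y)` of a plaque. -/
def plaqueDeriv (W : Foliation n k M) (p : M) (x : EuclideanSpace ℝ (Fin k))
    (y : EuclideanSpace ℝ (Fin (n - k))) :
    EuclideanSpace ℝ (Fin k) →ₗ[ℝ] TangentSpace (𝓡 n) (W.box p (x, y)) :=
  (mfderiv (𝓡 k) (𝓡 n) (fun u => W.box p (u, y)) x).toLinearMap

/-- The tangent space `T_p W` of the leaf through `p`: the tangent space at `p = box p (0, 0)` of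
the central plaque of the box centered at `p`. -/
def tangent (W : Foliation n k M) (p : M) : Submodule ℝ (TangentSpace (𝓡 n) p) :=
  W.box_zero p ▸ LinearMap.range (W.plaqueDeriv p 0 0)

instance (W : Foliation n k M) (p : M) : FiniteDimensional ℝ (W.tangent p) :=
  have : FiniteDimensional ℝ (TangentSpace (𝓡 n) p) :=
    inferInstanceAs (FiniteDimensional ℝ (EuclideanSpace ℝ (Fin n)))
  inferInstance

/-- A smooth disk of dimension `n - k` inside the box centered at `p`, parametrized by the open
unit ball, transverse to the foliation and meeting every plaque of the box at most once. -/
structure IsTransverseDisk (W : Foliation n k M) (p : M)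
    (τ : EuclideanSpace ℝ (Fin (n - k)) → M) : Prop where
  contMDiffOn : ContMDiffOn (𝓡 (n - k)) (𝓡 n) ∞ τ (Metric.ball 0 1)
  mem_box : ∀ t ∈ Metric.ball 0 1, τ t ∈ range (W.box p)
  isCompl : ∀ t ∈ Metric.ball 0 1,
    IsCompl (LinearMap.range (mfderiv (𝓡 (n - k)) (𝓡 n) τ t).toLinearMap) (W.tangent (τ t))
  eq_of_samePlaqueIn : ∀ s ∈ Metric.ball 0 1, ∀ t ∈ Metric.ball 0 1,
    W.SamePlaqueIn p (τ s) (τ t) → s = t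

/-- The foliation is absolutely continuous: near every point `p`, the holonomy map between any two
sufficiently small transverse smooth disks, which slides a point of the first disk along its plaque
to the second disk (wherever this is possible), maps null sets to null sets. Null sets
of a disk are taken in its smooth parametrization. -/
def IsAbsolutelyContinuous (W : Foliation n k M) : Prop :=
  ∀ p : M, ∃ U ∈ 𝓝 p, ∀ τ₁ τ₂ : EuclideanSpace ℝ (Fin (n - k)) → M,
    W.IsTransverseDisk p τ₁ → W.IsTransverseDisk p τ₂ →
    MapsTo τ₁ (Metric.ball 0 1) U → MapsTo τ₂ (Metric.ball 0 1) U →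
    ∀ N ⊆ Metric.ball (0 : EuclideanSpace ℝ (Fin (n - k))) 1, volume N = 0 →
      volume {t ∈ Metric.ball (0 : EuclideanSpace ℝ (Fin (n - k))) 1 |
        ∃ s ∈ N, W.SamePlaqueIn p (τ₁ s) (τ₂ t)} = 0

variable [RiemannianBundle (fun x : M => TangentSpace (𝓡 n) x)]

/-- The Riemannian `k`-volume of subsets of leaves. A subset of one plaque has the
volume given by the usual integral of the volume density over the parameter domain; this is
extended by countable covers. -/
def leafVolume (W : Foliation n k M) : OuterMeasure M :=
  OuterMeasure.boundedBy fun S =>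
    ⨅ (p : M) (y : EuclideanSpace ℝ (Fin (n - k))) (_ : S ⊆ range fun x => W.box p (x, y)),
      ∫⁻ x in (fun x => W.box p (x, y)) ⁻¹' S, ENNReal.ofReal (W.plaqueDeriv p x y).normDet

/-- The distance inside the leaf: the infimum of the lengths of `C^1` curves within the leaf. -/
def leafEDist (W : Foliation n k M) (x y : M) : ℝ≥0∞ :=
  ⨅ (γ : ℝ → M) (_ : ContMDiffOn 𝓘(ℝ, ℝ) (𝓡 n) 1 γ (Icc 0 1)) (_ : γ 0 = x) (_ : γ 1 = y)
    (_ : MapsTo γ (Icc 0 1) (W.leaf x)), pathELength (𝓡 n) γ 0 1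

/-- The disk `W_r(x)` of radius `r` centered at `x` in the leaf through `x`. -/
def leafDisk (W : Foliation n k M) (x : M) (r : ℝ) : Set M :=
  {y | W.leafEDist x y < ENNReal.ofReal r}

/-- The volume growth `χ(x, r) = limsup (1/i) ln Vol (f^i (W_r(x)))`. -/
def volumeGrowthAt (W : Foliation n k M) (f : M → M) (x : M) (r : ℝ) : EReal :=
  limsup (fun i : ℕ => ENNReal.log (W.leafVolume (f^[i] '' W.leafDisk x r)) / (i : EReal)) atTop

/-- The maximal volume growth `χ(r) = sup_x χ(x, r)`. -/
def maxVolumeGrowth (W : Foliation n k M) (f : M → M) (r : ℝ) : EReal :=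
  ⨆ x, W.volumeGrowthAt f x r

/-- The leafwise Jacobian `‖Λ^k D_x g|_{Λ^k T_x W}‖`, the `k`-volume factor of `D_x g` restricted
to `T_x W`. -/
def leafJacobian (W : Foliation n k M) (g : M → M) (x : M) : ℝ :=
  ((mfderiv (𝓡 n) (𝓡 n) g x).toLinearMap.domRestrict (W.tangent x)).normDet

/-- The pointwise Lyapunov exponent of `k`-volume along the leaves,
`Λ_W(x) = lim (1/j) log ‖Λ^k D_x f^j|_{Λ^k T_x W}‖` (the sum of the Lyapunov exponents in
`T_x W`). -/
def lyapunovExponent (W : Foliation n k M) (f : M → M) (x : M) : ℝ :=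
  limUnder atTop fun j : ℕ => Real.log (W.leafJacobian f^[j] x) / j

/-- The integrated Lyapunov exponent `Λ_W = ∫ Λ_W(x) dμ`. -/
def integratedLyapunovExponent [MeasurableSpace M] (W : Foliation n k M) (f : M → M)
    (μ : Measure M) : ℝ :=
  ∫ x, W.lyapunovExponent f x ∂μ

end Foliation

/-- A smooth volume: in every chart of the atlas the measure has a smooth positive density with
respect to Lebesgue measure. -/
def IsSmoothVolume (n : ℕ) {M : Type*} [TopologicalSpace M]
    [ChartedSpace (EuclideanSpace ℝ (Fin n)) M] [MeasurableSpace M] (μ : Measure M) : Prop :=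
  ∀ c ∈ atlas (EuclideanSpace ℝ (Fin n)) M, ∃ ρ : EuclideanSpace ℝ (Fin n) → ℝ,
    ContDiffOn ℝ ∞ ρ c.target ∧ (∀ y ∈ c.target, 0 < ρ y) ∧
    ∀ A ⊆ c.source, MeasurableSet A → μ A = ∫⁻ y in c '' A, ENNReal.ofReal (ρ y)

end

/-! The chain rule for `leafJacobian` and the invariance of `W` make `log Jac (f^j)` the Birkhoff
sum of the continuous, hence bounded, function `log Jac f`. Birkhoff's theorem
(`ae_tendsto_birkhoffAverage`, derived from the maximal ergodic theorem) gives the limit almost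
everywhere, its integrability and the formula for its integral.

For the inequality, suppose that the volume growth for some radius is below `b < a < Λ_W`. The
exponent exceeds `a` on a set of positive measure, so for some `N` the closed set `A N` of points
with `Jac (f^j) ≥ exp (a j)` for all `j ≥ N` has positive measure. By absolute continuity some
plaque meets `A N` in positive `k`-volume (`IsAbsolutelyContinuous.measure_eq_zero`). A leaf disk of
the given radius, centred at a suitable point of this plaque, then contains a piece of `A N` of some
volume `c > 0`. The image of this piece under `f^j` has volume at least `c * exp (a j)`, so the
growth is at least `b` (`le_maxVolumeGrowth`), a contradiction.

Two points carry the weight. First, invariance speaks of leaves as sets, whereas Jacobians and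
volumes need plaques. A leaf meets a box in countably many plaques, and a continuous transverse
coordinate with countably many values is constant on a ball, so `f` maps plaques locally into
plaques (`eventually_mem_plaque`) and the change of variables formula applies. Second, absolute
continuity is stated for holonomy maps. In a chart at `p` whose horizontal plane is `T_p W`, the
plaques are nearly horizontal and the vertical disks are transversals. Fubini's theorem is then used
twice, with the holonomy from the central vertical disk in between
(`measure_image_eq_zero_of_holonomy`). -/

/-! ### Pointwise properties of Birkhoff sums and upper averages -/

section BirkhoffSums

variable {α : Type*} {f : α → α}

/-- The maximum of the first `n` Birkhoff sums (including the empty sum). -/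
noncomputable def maxBirkhoffSum (f : α → α) (ψ : α → ℝ) : ℕ → α → ℝ
  | 0 => fun _ => 0
  | n + 1 => fun x => max 0 (ψ x + maxBirkhoffSum f ψ n (f x))

lemma maxBirkhoffSum_nonneg (ψ : α → ℝ) (n : ℕ) (x : α) : 0 ≤ maxBirkhoffSum f ψ n x := by
  cases n with
  | zero => exact le_rfl
  | succ n => exact le_max_left _ _

lemma maxBirkhoffSum_le_succ (ψ : α → ℝ) (n : ℕ) (x : α) :
    maxBirkhoffSum f ψ n x ≤ maxBirkhoffSum f ψ (n + 1) x := by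
  induction n generalizing x with
  | zero => exact maxBirkhoffSum_nonneg ψ 1 x
  | succ n ih =>
    exact max_le_max le_rfl (add_le_add_right (ih (f x)) _)

lemma birkhoffSum_le_maxBirkhoffSum (ψ : α → ℝ) (n : ℕ) (x : α) :
    birkhoffSum f ψ n x ≤ maxBirkhoffSum f ψ n x := by
  induction n generalizing x with
  | zero => simp [maxBirkhoffSum]
  | succ n ih =>
    rw [birkhoffSum_succ']
    exact le_trans (add_le_add_right (ih (f x)) _) (le_max_right _ _)

lemma abs_birkhoffAverage_le {φ : α → ℝ} {C : ℝ} (hC : ∀ x, |φ x| ≤ C) (n : ℕ) (x : α) :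
    |birkhoffAverage ℝ f φ n x| ≤ C := by
  have h0 : 0 ≤ C := (abs_nonneg _).trans (hC x)
  rcases Nat.eq_zero_or_pos n with rfl | hn
  · simpa using h0
  rw [birkhoffAverage, smul_eq_mul, abs_mul, abs_of_nonneg (by positivity),
    inv_mul_le_iff₀ (by positivity)]
  refine (Finset.abs_sum_le_sum_abs _ _).trans ?_
  refine (Finset.sum_le_sum fun i _ => hC _).trans ?_
  simp

/-- The upper Birkhoff average. -/
noncomputable def upperBirkhoffAverage (f : α → α) (φ : α → ℝ) (x : α) : ℝ :=
  limsup (fun n => birkhoffAverage ℝ f φ n x) atTop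

variable {φ : α → ℝ} {C : ℝ}

lemma isBoundedUnder_le_birkhoffAverage (hC : ∀ x, |φ x| ≤ C) (x : α) :
    IsBoundedUnder (· ≤ ·) atTop fun n => birkhoffAverage ℝ f φ n x :=
  isBoundedUnder_of ⟨C, fun n => (abs_le.1 (abs_birkhoffAverage_le hC n x)).2⟩

lemma isBoundedUnder_ge_birkhoffAverage (hC : ∀ x, |φ x| ≤ C) (x : α) :
    IsBoundedUnder (· ≥ ·) atTop fun n => birkhoffAverage ℝ f φ n x :=
  isBoundedUnder_of ⟨-C, fun n => (abs_le.1 (abs_birkhoffAverage_le hC n x)).1⟩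

lemma abs_upperBirkhoffAverage_le (hC : ∀ x, |φ x| ≤ C) (x : α) :
    |upperBirkhoffAverage f φ x| ≤ C := by
  rw [abs_le]
  constructor
  · exact le_limsup_of_frequently_le (Frequently.of_forall fun n =>
      (abs_le.1 (abs_birkhoffAverage_le hC n x)).1) (isBoundedUnder_le_birkhoffAverage hC x)
  · exact limsup_le_of_le (isBoundedUnder_ge_birkhoffAverage hC x).isCoboundedUnder_le
      (Eventually.of_forall fun n => (abs_le.1 (abs_birkhoffAverage_le hC n x)).2)

lemma limsup_le_limsup_of_tendsto_sub {u v : ℕ → ℝ} (h : Tendsto (fun n => u n - v n) atTop (𝓝 0))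
    (hu : IsBoundedUnder (· ≥ ·) atTop u) (hv : IsBoundedUnder (· ≤ ·) atTop v) :
    limsup u atTop ≤ limsup v atTop := by
  refine le_of_forall_pos_le_add fun ε hε => ?_
  refine limsup_le_of_le hu.isCoboundedUnder_le ?_
  filter_upwards [eventually_lt_of_limsup_lt (show limsup v atTop < limsup v atTop + ε / 2 by
    linarith) hv, h.eventually_lt_const (show (0 : ℝ) < ε / 2 by linarith)] with n h1 h2
  linarith

lemma upperBirkhoffAverage_apply (hC : ∀ x, |φ x| ≤ C) (x : α) :
    upperBirkhoffAverage f φ (f x) = upperBirkhoffAverage f φ x := by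
  have ht : Tendsto (fun n => birkhoffAverage ℝ f φ n (f x) - birkhoffAverage ℝ f φ n x) atTop
      (𝓝 0) :=
    tendsto_birkhoffAverage_apply_sub_birkhoffAverage' ℝ (g := φ)
      (isBounded_iff_forall_norm_le.2 ⟨C, by rintro _ ⟨y, rfl⟩; exact hC y⟩) f x
  refine le_antisymm (limsup_le_limsup_of_tendsto_sub ht (isBoundedUnder_ge_birkhoffAverage hC _)
    (isBoundedUnder_le_birkhoffAverage hC _)) (limsup_le_limsup_of_tendsto_sub ?_
      (isBoundedUnder_ge_birkhoffAverage hC _) (isBoundedUnder_le_birkhoffAverage hC _))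
  simpa using ht.neg

/-- The upper average is constant along orbits, and some average of `φ` exceeds its limsup minus
`ε`. This is the input to the maximal ergodic theorem. -/
lemma exists_birkhoffSum_pos (hC : ∀ x, |φ x| ≤ C) {ε : ℝ} (hε : 0 < ε) (x : α) :
    ∃ n, 0 < birkhoffSum f (fun x => φ x - upperBirkhoffAverage f φ x + ε) n x := by
  have hinv : ∀ n, upperBirkhoffAverage f φ (f^[n] x) = upperBirkhoffAverage f φ x := by
    intro n
    induction n with
    | zero => rfl
    | succ n ih => rw [Function.iterate_succ_apply', upperBirkhoffAverage_apply hC, ih]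
  have hfr : ∃ᶠ n in atTop, upperBirkhoffAverage f φ x - ε < birkhoffAverage ℝ f φ n x :=
    frequently_lt_of_lt_limsup (isBoundedUnder_ge_birkhoffAverage hC x).isCoboundedUnder_le
      (by simpa [upperBirkhoffAverage] using hε)
  obtain ⟨n, hn1, hn⟩ := (hfr.and_eventually (eventually_gt_atTop 0)).exists
  refine ⟨n, ?_⟩
  have h0 : (0 : ℝ) < n := by exact_mod_cast hn
  have h1 : birkhoffSum f (fun x => φ x - upperBirkhoffAverage f φ x + ε) n x =
      birkhoffSum f φ n x - n * (upperBirkhoffAverage f φ x - ε) := by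
    simp only [birkhoffSum, hinv, Finset.sum_add_distrib, Finset.sum_sub_distrib,
      Finset.sum_const, Finset.card_range, nsmul_eq_mul]
    ring
  rw [birkhoffAverage, smul_eq_mul, lt_inv_mul_iff₀ h0] at hn1
  rw [h1]
  linarith

lemma birkhoffAverage_neg_fun (n : ℕ) (x : α) :
    birkhoffAverage ℝ f (fun y => -φ y) n x = -birkhoffAverage ℝ f φ n x := by
  simp [birkhoffAverage, birkhoffSum]

lemma tendsto_birkhoffAverage_of_upperBirkhoffAverage_eq (hC : ∀ x, |φ x| ≤ C) (x : α) {a : ℝ}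
    (h1 : upperBirkhoffAverage f φ x = a)
    (h2 : upperBirkhoffAverage f (fun y => -φ y) x = -a) :
    Tendsto (fun n => birkhoffAverage ℝ f φ n x) atTop (𝓝 a) := by
  have hC' : ∀ x, |(fun y => -φ y) x| ≤ C := fun x => by simpa using hC x
  rw [tendsto_order]
  constructor
  · intro b hb
    have h3 : limsup (fun n => birkhoffAverage ℝ f (fun y => -φ y) n x) atTop < -b := by
      change upperBirkhoffAverage f (fun y => -φ y) x < -b
      linarith
    filter_upwards [eventually_lt_of_limsup_lt h3 (isBoundedUnder_le_birkhoffAverage hC' x)]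
      with n hn
    rw [birkhoffAverage_neg_fun] at hn
    linarith
  · intro b hb
    have h3 : limsup (fun n => birkhoffAverage ℝ f φ n x) atTop < b := h1.trans_lt hb
    exact eventually_lt_of_limsup_lt h3 (isBoundedUnder_le_birkhoffAverage hC x)

end BirkhoffSums

/-! ### The maximal ergodic theorem and Birkhoff's theorem -/

section Birkhoff

variable {α : Type*} [MeasurableSpace α] {μ : Measure α} {f : α → α}

lemma integrable_maxBirkhoffSum (hf : MeasurePreserving f μ μ) {ψ : α → ℝ}
    (hψ : Integrable ψ μ) (n : ℕ) : Integrable (maxBirkhoffSum f ψ n) μ := by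
  induction n with
  | zero => exact integrable_zero _ _ _
  | succ n ih => exact (integrable_zero _ _ _).sup (hψ.add (hf.integrable_comp_of_integrable ih))

lemma measurable_maxBirkhoffSum (hf : Measurable f) {ψ : α → ℝ}
    (hψ : Measurable ψ) (n : ℕ) : Measurable (maxBirkhoffSum f ψ n) := by
  induction n with
  | zero => exact measurable_const
  | succ n ih => exact measurable_const.max (hψ.add (ih.comp hf))

/-- The maximal ergodic theorem. -/
theorem setIntegral_maxBirkhoffSum_pos_nonneg (hf : MeasurePreserving f μ μ) {ψ : α → ℝ}
    (hψm : Measurable ψ) (hψ : Integrable ψ μ) (n : ℕ) :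
    0 ≤ ∫ x in {x | 0 < maxBirkhoffSum f ψ n x}, ψ x ∂μ := by
  cases n with
  | zero => simp [maxBirkhoffSum]
  | succ n =>
    set m := maxBirkhoffSum f ψ (n + 1) with hm
    have hmm : Measurable m := measurable_maxBirkhoffSum hf.measurable hψm _
    have hS : MeasurableSet {x | 0 < m x} := measurableSet_lt measurable_const hmm
    have hmi : Integrable m μ := integrable_maxBirkhoffSum hf hψ _
    have hmf : Integrable (fun x => m (f x)) μ := hf.integrable_comp_of_integrable hmi
    have h0 : ∫ x, (m x - m (f x)) ∂μ = 0 := by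
      rw [integral_sub hmi hmf, ← integral_map hf.aemeasurable
        (hmm.aestronglyMeasurable), hf.map_eq, sub_self]
    rw [← integral_indicator hS]
    refine h0.symm.le.trans ?_
    -- The key is the pointwise bound `m - m ∘ f ≤ 1_{m > 0} ψ`, whose left side has integral zero
    -- by invariance of `μ`.
    refine integral_mono (hmi.sub hmf) (hψ.indicator hS) fun x => ?_
    by_cases hx : 0 < m x
    · rw [indicator_of_mem (by exact hx)]
      have h1 : m x = ψ x + maxBirkhoffSum f ψ n (f x) := by
        rcases max_choice 0 (ψ x + maxBirkhoffSum f ψ n (f x)) with h | h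
        · exact absurd (h : m x = 0) hx.ne'
        · exact h
      have h2 := maxBirkhoffSum_le_succ (f := f) ψ n (f x)
      simp only [hm] at h1 ⊢
      linarith
    · rw [indicator_of_notMem (by exact hx)]
      have h1 := maxBirkhoffSum_nonneg (f := f) ψ (n + 1) (f x)
      simp only [not_lt, hm] at hx ⊢
      linarith

/-- If some Birkhoff sum is positive at every point, then the integral is nonnegative. -/
theorem integral_nonneg_of_exists_birkhoffSum_pos (hf : MeasurePreserving f μ μ) {ψ : α → ℝ}
    (hψm : Measurable ψ) (hψ : Integrable ψ μ) (h : ∀ x, ∃ n, 0 < birkhoffSum f ψ n x) :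
    0 ≤ ∫ x, ψ x ∂μ := by
  have hmono : Monotone fun n => {x | 0 < maxBirkhoffSum f ψ n x} :=
    monotone_nat_of_le_succ fun n x hx => lt_of_lt_of_le hx (maxBirkhoffSum_le_succ ψ n x)
  have hU : ⋃ n, {x | 0 < maxBirkhoffSum f ψ n x} = univ :=
    eq_univ_of_forall fun x => by
      obtain ⟨n, hn⟩ := h x
      exact mem_iUnion.2 ⟨n, hn.trans_le (birkhoffSum_le_maxBirkhoffSum ψ n x)⟩
  have ht := tendsto_setIntegral_of_monotone (μ := μ) (f := ψ)
    (fun n => measurableSet_lt measurable_const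
      (measurable_maxBirkhoffSum hf.measurable hψm n)) hmono hψ.integrableOn
  rw [hU, setIntegral_univ] at ht
  exact ge_of_tendsto' ht fun n => setIntegral_maxBirkhoffSum_pos_nonneg hf hψm hψ n

variable {φ : α → ℝ} {C : ℝ}

lemma measurable_upperBirkhoffAverage (hf : Measurable f) (hφ : Measurable φ) :
    Measurable (upperBirkhoffAverage f φ) := by
  refine Measurable.limsup fun n => ?_
  have : birkhoffAverage ℝ f φ n = fun x => (n : ℝ)⁻¹ • ∑ i ∈ Finset.range n, φ (f^[i] x) := rfl
  rw [this]
  have hs : Measurable fun x => ∑ i ∈ Finset.range n, φ (f^[i] x) :=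
    Finset.measurable_fun_sum _ fun i _ => hφ.comp (hf.iterate i)
  exact hs.const_smul (n : ℝ)⁻¹

variable [IsProbabilityMeasure μ]

lemma integrable_of_abs_le {ψ : α → ℝ} (hψ : Measurable ψ) (hC : ∀ x, |ψ x| ≤ C) :
    Integrable ψ μ :=
  Integrable.of_bound hψ.aestronglyMeasurable C (Eventually.of_forall hC)

/-- The function `φ - upperBirkhoffAverage f φ + ε` has a positive Birkhoff sum at every point,
hence a nonnegative integral; let `ε` tend to zero. -/
lemma integral_upperBirkhoffAverage_le (hf : MeasurePreserving f μ μ) (hφ : Measurable φ)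
    (hC : ∀ x, |φ x| ≤ C) : ∫ x, upperBirkhoffAverage f φ x ∂μ ≤ ∫ x, φ x ∂μ := by
  have hm := measurable_upperBirkhoffAverage hf.measurable hφ
  have hi : Integrable φ μ := integrable_of_abs_le hφ hC
  have hi' : Integrable (upperBirkhoffAverage f φ) μ :=
    integrable_of_abs_le hm (abs_upperBirkhoffAverage_le hC)
  refine le_of_forall_pos_le_add fun ε hε => ?_
  have h := integral_nonneg_of_exists_birkhoffSum_pos hf ((hφ.sub hm).add_const ε)
    ((hi.sub hi').add (integrable_const ε)) (exists_birkhoffSum_pos hC hε)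
  have h2 : ∫ x, (φ x - upperBirkhoffAverage f φ x + ε) ∂μ =
      ∫ x, φ x ∂μ - ∫ x, upperBirkhoffAverage f φ x ∂μ + ε := by
    have h1 := integral_add (hi.sub hi') (integrable_const ε)
    simp only [Pi.sub_apply, integral_sub hi hi', integral_const, probReal_univ, one_smul] at h1
    exact h1
  have h3 : 0 ≤ ∫ x, (φ x - upperBirkhoffAverage f φ x + ε) ∂μ := h
  linarith

/-- Birkhoff's pointwise ergodic theorem for bounded observables. -/
theorem ae_tendsto_birkhoffAverage (hf : MeasurePreserving f μ μ) (hφ : Measurable φ)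
    (hC : ∀ x, |φ x| ≤ C) :
    (∀ᵐ x ∂μ, Tendsto (fun n => birkhoffAverage ℝ f φ n x) atTop
      (𝓝 (upperBirkhoffAverage f φ x))) ∧
    Integrable (upperBirkhoffAverage f φ) μ ∧
    ∫ x, upperBirkhoffAverage f φ x ∂μ = ∫ x, φ x ∂μ := by
  have hC' : ∀ x, |(fun y => -φ y) x| ≤ C := fun x => by simpa using hC x
  set u := upperBirkhoffAverage f φ
  set v := upperBirkhoffAverage f fun y => -φ y
  have hu : Integrable u μ := integrable_of_abs_le
    (measurable_upperBirkhoffAverage hf.measurable hφ) (abs_upperBirkhoffAverage_le hC)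
  have hv : Integrable v μ := integrable_of_abs_le
    (measurable_upperBirkhoffAverage hf.measurable hφ.neg) (abs_upperBirkhoffAverage_le hC')
  have hu1 := integral_upperBirkhoffAverage_le hf hφ hC
  have hv1 : ∫ x, v x ∂μ ≤ ∫ x, -φ x ∂μ := integral_upperBirkhoffAverage_le hf hφ.neg hC'
  rw [integral_neg] at hv1
  have hnn : ∀ x, 0 ≤ u x + v x := by
    intro x
    refine le_of_forall_pos_le_add fun ε hε => ?_
    have h1 : ∀ᶠ n in atTop, birkhoffAverage ℝ f φ n x < u x + ε / 2 :=
      eventually_lt_of_limsup_lt (show u x < u x + ε / 2 by linarith)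
        (isBoundedUnder_le_birkhoffAverage hC x)
    have h2 : ∀ᶠ n in atTop, birkhoffAverage ℝ f (fun y => -φ y) n x < v x + ε / 2 :=
      eventually_lt_of_limsup_lt (show v x < v x + ε / 2 by linarith)
        (isBoundedUnder_le_birkhoffAverage hC' x)
    obtain ⟨n, hn1, hn2⟩ := (h1.and h2).exists
    rw [birkhoffAverage_neg_fun] at hn2
    linarith
  -- Here `u` is the limsup and `-v` the liminf of the averages. Applying the integral inequality to
  -- `φ` and to `-φ` shows that the nonnegative gap `u + v` has integral at most zero.
  have h0 : ∫ x, (u x + v x) ∂μ = 0 := by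
    refine le_antisymm ?_ (integral_nonneg hnn)
    rw [integral_add hu hv]
    linarith
  have hae := (integral_eq_zero_iff_of_nonneg hnn (hu.add hv)).1 h0
  refine ⟨?_, hu, ?_⟩
  · filter_upwards [hae] with x hx
    have hx' : u x + v x = 0 := hx
    exact tendsto_birkhoffAverage_of_upperBirkhoffAverage_eq hC x rfl (by change v x = -u x; linarith)
  · refine le_antisymm hu1 ?_
    rw [integral_add hu hv] at h0
    linarith

end Birkhoff

/-! ### Countability of the plaques of a leaf; leaf-preserving maps respect plaques -/

lemma countable_setOf_reflTransGen {α : Type*} {R : α → α → Prop}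
    (h : ∀ a, {b | R a b}.Countable) (a : α) : {b | Relation.ReflTransGen R a b}.Countable := by
  let S : ℕ → Set α := fun m => Nat.rec {a} (fun _ s => ⋃ c ∈ s, {b | R c b}) m
  have hS : ∀ m, (S m).Countable := by
    intro m
    induction m with
    | zero => exact countable_singleton a
    | succ m ih => exact ih.biUnion fun c _ => h c
  refine (countable_iUnion hS).mono fun b hb => ?_
  induction hb with
  | refl => exact mem_iUnion.2 ⟨0, rfl⟩
  | tail _ hbc ih =>
    obtain ⟨m, hm⟩ := mem_iUnion.1 ih
    exact mem_iUnion.2 ⟨m + 1, mem_biUnion hm hbc⟩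

namespace Foliation

variable {n k : ℕ} {M : Type*} [TopologicalSpace M]
  [ChartedSpace (EuclideanSpace ℝ (Fin n)) M] [IsManifold (𝓡 n) ∞ M] (W : Foliation n k M)

/-- The foliation box centered at `p` as a partial homeomorphism. -/
noncomputable def boxHomeo (p : M) :
    OpenPartialHomeomorph (EuclideanSpace ℝ (Fin k) × EuclideanSpace ℝ (Fin (n - k))) M :=
  (W.isOpenEmbedding_box p).toOpenPartialHomeomorph (W.box p)

lemma boxHomeo_symm_box (p : M) (z : EuclideanSpace ℝ (Fin k) × EuclideanSpace ℝ (Fin (n - k))) :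
    (W.boxHomeo p).symm (W.box p z) = z :=
  (W.boxHomeo p).left_inv (mem_univ z)

lemma continuousOn_boxHomeo_symm (p : M) :
    ContinuousOn (W.boxHomeo p).symm (range (W.box p)) := by
  have h := (W.boxHomeo p).continuousOn_symm
  rwa [show (W.boxHomeo p).target = range (W.box p) from image_univ] at h

lemma box_boxHomeo_symm {p a : M} (h : a ∈ range (W.box p)) :
    W.box p ((W.boxHomeo p).symm a) = a := by
  obtain ⟨z, rfl⟩ := h
  rw [boxHomeo_symm_box]

lemma mem_range_box_self (p : M) : p ∈ range (W.box p) := ⟨(0, 0), W.box_zero p⟩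

lemma continuous_box (p : M) : Continuous (W.box p) := (W.isOpenEmbedding_box p).continuous

lemma injective_box (p : M) : Function.Injective (W.box p) := (W.isOpenEmbedding_box p).injective

lemma continuous_plaque (p : M) (y : EuclideanSpace ℝ (Fin (n - k))) :
    Continuous fun x => W.box p (x, y) :=
  (W.continuous_box p).comp (by fun_prop)

lemma isOpen_setOf_mem_plaque (p q : M) (y v : EuclideanSpace ℝ (Fin (n - k))) :
    IsOpen {x | ∃ u, W.box p (x, y) = W.box q (u, v)} :=
  isOpen_iff_eventually.2 fun _ ⟨_, hu⟩ => W.compatible _ _ _ _ _ _ hu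

/-- A plaque meets countably many plaques of a box. -/
lemma countable_setOf_plaque_meets (p q : M) (y : EuclideanSpace ℝ (Fin (n - k))) :
    {v | ∃ x u, W.box p (x, y) = W.box q (u, v)}.Countable := by
  -- The parameter sets where the plaque meets different plaques of the box are open, nonempty and
  -- disjoint in a separable space.
  refine PairwiseDisjoint.countable_of_isOpen
    (s := fun v => {x | ∃ u, W.box p (x, y) = W.box q (u, v)}) ?_
    (fun v _ => W.isOpen_setOf_mem_plaque p q y v) (fun v hv => hv)
  intro v _ v' _ hne
  refine disjoint_left.2 ?_
  rintro x ⟨u, hu⟩ ⟨u', hu'⟩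
  exact hne (congrArg Prod.snd (W.injective_box q (hu.symm.trans hu')))

lemma samePlaqueIn_symm {p a b : M} (h : W.SamePlaqueIn p a b) : W.SamePlaqueIn p b a := by
  obtain ⟨x, x', y, h1, h2⟩ := h
  exact ⟨x', x, y, h2, h1⟩

lemma mem_leaf_of_samePlaqueIn {p a b : M} (h : W.SamePlaqueIn p a b) : b ∈ W.leaf a :=
  Relation.EqvGen.rel _ _ ⟨p, h⟩

/-- Every leaf is contained in a countable union of plaques. -/
lemma exists_countable_leaf_subset [CompactSpace M] (a : M) :
    ∃ C : Set (M × EuclideanSpace ℝ (Fin (n - k))), C.Countable ∧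
      W.leaf a ⊆ ⋃ c ∈ C, range fun x => W.box c.1 (x, c.2) := by
  obtain ⟨P, hP⟩ := CompactSpace.elim_nhds_subcover (fun p => range (W.box p))
    fun p => (W.isOpenEmbedding_box p).isOpen_range.mem_nhds (W.mem_range_box_self p)
  have hcov : ∀ b, ∃ q ∈ P, ∃ u v, W.box q (u, v) = b := by
    intro b
    have hb : b ∈ ⋃ x ∈ P, range (W.box x) := by rw [hP]; exact mem_univ b
    obtain ⟨q, hq, ⟨⟨u, v⟩, huv⟩⟩ := mem_iUnion₂.1 hb
    exact ⟨q, hq, u, v, huv⟩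
  -- Successors are restricted to the finite cover `P`, so that each plaque has only countably many.
  let R : M × EuclideanSpace ℝ (Fin (n - k)) → M × EuclideanSpace ℝ (Fin (n - k)) → Prop :=
    fun c d => d.1 ∈ P ∧ ∃ x u, W.box c.1 (x, c.2) = W.box d.1 (u, d.2)
  have hR : ∀ c, {d | R c d}.Countable := by
    intro c
    refine (P.countable_toSet.biUnion fun q _ =>
      (W.countable_setOf_plaque_meets c.1 q c.2).image (Prod.mk q)).mono ?_
    rintro ⟨q, v⟩ ⟨hq, hx⟩
    exact mem_biUnion hq ⟨v, hx, rfl⟩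
  obtain ⟨q₀, hq₀, u₀, v₀, h₀⟩ := hcov a
  set C := {d | Relation.ReflTransGen R (q₀, v₀) d} with hC
  have hstep : ∀ c ∈ C, ∀ d, R c d → d ∈ C := fun c hc d hd => hc.tail hd
  refine ⟨C, countable_setOf_reflTransGen hR _, ?_⟩
  set U := ⋃ c ∈ C, range fun x => W.box c.1 (x, c.2) with hU
  have hdir : ∀ p b b', W.SamePlaqueIn p b b' → b ∈ U → b' ∈ U := by
    rintro p _ _ ⟨x, x', y, rfl, rfl⟩ hb
    have hopen : IsOpen {x | W.box p (x, y) ∈ U} := by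
      have : {x | W.box p (x, y) ∈ U} =
          ⋃ c ∈ C, {x | ∃ u, W.box p (x, y) = W.box c.1 (u, c.2)} := by
        ext x
        simp only [hU, mem_iUnion, mem_range, mem_ofPred_eq, eq_comm]
      rw [this]
      exact isOpen_biUnion fun c _ => W.isOpen_setOf_mem_plaque _ _ _ _
    -- If points arbitrarily close to `x₀` lie in `U`, then the plaque of the finite cover through
    -- the image of `x₀` meets a plaque of `C`, so it belongs to `C` itself. Connectedness of the
    -- parameter space then puts the whole plaque in `U`.
    have hclosed : IsClosed {x | W.box p (x, y) ∈ U} := by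
      rw [← isOpen_compl_iff, isOpen_iff_eventually]
      intro x₀ hx₀
      obtain ⟨q, hq, u, v, huv⟩ := hcov (W.box p (x₀, y))
      filter_upwards [W.compatible _ _ _ _ _ _ huv.symm] with x₁ ⟨u₁, hu₁⟩ hx₁
      obtain ⟨c, hc, w, hw⟩ := mem_iUnion₂.1 hx₁
      exact hx₀ (mem_iUnion₂.2 ⟨(q, v), hstep c hc _ ⟨hq, w, u₁, hw.trans hu₁⟩, u, huv⟩)
    have huniv := IsClopen.eq_univ ⟨hclosed, hopen⟩ ⟨x, hb⟩
    have : x' ∈ {x | W.box p (x, y) ∈ U} := huniv ▸ mem_univ x'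
    exact this
  have hiff : ∀ b b', Relation.EqvGen (fun a b => ∃ p, W.SamePlaqueIn p a b) b b' →
      (b ∈ U ↔ b' ∈ U) := by
    intro b b' h
    induction h with
    | rel _ _ h =>
      obtain ⟨p, hp⟩ := h
      exact ⟨hdir p _ _ hp, hdir p _ _ (W.samePlaqueIn_symm hp)⟩
    | refl _ => rfl
    | symm _ _ _ ih => exact ih.symm
    | trans _ _ _ _ _ ih1 ih2 => exact ih1.trans ih2
  intro b hb
  exact (hiff a b hb).1 (mem_iUnion₂.2 ⟨(q₀, v₀), Relation.ReflTransGen.refl, u₀, h₀⟩)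

/-- A leaf meets a box in countably many plaques. -/
lemma countable_setOf_leaf_meets_plaque [CompactSpace M] (a q : M) :
    {v | ∃ u, W.box q (u, v) ∈ W.leaf a}.Countable := by
  obtain ⟨C, hC, hsub⟩ := W.exists_countable_leaf_subset a
  refine (hC.biUnion fun c _ => W.countable_setOf_plaque_meets c.1 q c.2).mono ?_
  rintro v ⟨u, hu⟩
  obtain ⟨c, hc, x, hx⟩ := mem_iUnion₂.1 (hsub hu)
  exact mem_biUnion hc ⟨x, u, hx⟩

/-- A continuous map preserving the leaves maps plaques locally into plaques. -/
lemma eventually_mem_plaque [CompactSpace M] {g : M → M} (hg : Continuous g)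
    (hW : ∀ a, g '' W.leaf a ⊆ W.leaf (g a)) {p q : M} {x u : EuclideanSpace ℝ (Fin k)}
    {y v : EuclideanSpace ℝ (Fin (n - k))} (h : g (W.box p (x, y)) = W.box q (u, v)) :
    ∀ᶠ x' in 𝓝 x, ∃ u', g (W.box p (x', y)) = W.box q (u', v) := by
  have hc : Continuous fun x => g (W.box p (x, y)) := hg.comp (W.continuous_plaque p y)
  obtain ⟨ε, hε, hball⟩ := Metric.isOpen_iff.1
    ((W.isOpenEmbedding_box q).isOpen_range.preimage hc) x ⟨(u, v), h.symm⟩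
  let w := fun x' => ((W.boxHomeo q).symm (g (W.box p (x', y)))).2
  have hw : ContinuousOn w (Metric.ball x ε) :=
    continuous_snd.comp_continuousOn ((W.continuousOn_boxHomeo_symm q).comp hc.continuousOn hball)
  -- The image stays in one leaf, so the transverse coordinate `w` takes countably many values;
  -- being continuous on a ball, it is constant.
  have hcount : (w '' Metric.ball x ε).Countable := by
    refine (W.countable_setOf_leaf_meets_plaque (g (W.box p (x, y))) q).mono ?_
    rintro _ ⟨x', hx', rfl⟩
    refine ⟨((W.boxHomeo q).symm (g (W.box p (x', y)))).1, ?_⟩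
    rw [W.box_boxHomeo_symm (hball hx')]
    exact hW _ (mem_image_of_mem g (W.mem_leaf_of_samePlaqueIn ⟨x, x', y, rfl, rfl⟩))
  have hsub : (w '' Metric.ball x ε).Subsingleton :=
    hcount.isTotallyDisconnected _ Subset.rfl
      ((convex_ball x ε).isPreconnected.image w hw)
  filter_upwards [Metric.ball_mem_nhds x hε] with x' hx'
  refine ⟨((W.boxHomeo q).symm (g (W.box p (x', y)))).1, ?_⟩
  have h1 : w x' = v := by
    rw [hsub (mem_image_of_mem w hx') (mem_image_of_mem w (Metric.mem_ball_self hε))]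
    simp only [w, h, boxHomeo_symm_box]
  rw [← h1]
  exact (W.box_boxHomeo_symm (hball hx')).symm

end Foliation

/-! ### Transition maps between plaques and the tangent planes -/

lemma LinearMap.range_eq_of_eq_comp_injective {U V : Type*} [AddCommGroup U] [Module ℝ U]
    [FiniteDimensional ℝ U] [AddCommGroup V] [Module ℝ V] {A B : U →ₗ[ℝ] V} {C : U →ₗ[ℝ] U}
    (h : A = B ∘ₗ C) (hA : Function.Injective A) (hB : Function.Injective B) :
    LinearMap.range A = LinearMap.range B :=
  Submodule.eq_of_le_of_finrank_eq (h ▸ LinearMap.range_comp_le_range _ _)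
    ((LinearMap.finrank_range_of_inj hA).trans (LinearMap.finrank_range_of_inj hB).symm)

section Immersion

variable {n k : ℕ} {M : Type*} [TopologicalSpace M]
  [ChartedSpace (EuclideanSpace ℝ (Fin n)) M] [IsManifold (𝓡 n) ∞ M]

/-- A continuous lift of a differentiable map through an immersion is differentiable. -/
lemma differentiableAt_of_comp_immersion {φ ψ : EuclideanSpace ℝ (Fin k) → M}
    {θ : EuclideanSpace ℝ (Fin k) → EuclideanSpace ℝ (Fin k)} {x : EuclideanSpace ℝ (Fin k)}
    (hψ : ContMDiffAt (𝓡 k) (𝓡 n) 1 ψ (θ x))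
    (hinj : Function.Injective (mfderiv (𝓡 k) (𝓡 n) ψ (θ x)))
    (hφ : MDifferentiableAt (𝓡 k) (𝓡 n) φ x) (hθ : ContinuousAt θ x)
    (h : ψ ∘ θ =ᶠ[𝓝 x] φ) : DifferentiableAt ℝ θ x := by
  have hx : ψ (θ x) = φ x := h.eq_of_nhds
  set c := extChartAt (𝓡 n) (ψ (θ x)) with hc
  have hcM : ContMDiffAt (𝓡 n) 𝓘(ℝ, EuclideanSpace ℝ (Fin n)) 1 c (ψ (θ x)) :=
    contMDiffAt_extChartAt
  have hψc : ContDiffAt ℝ 1 (c ∘ ψ) (θ x) :=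
    (ContMDiffAt.comp (θ x) hcM hψ).contDiffAt
  have hφc : DifferentiableAt ℝ (c ∘ φ) x := by
    have h1 : MDifferentiableAt (𝓡 n) 𝓘(ℝ, EuclideanSpace ℝ (Fin n)) c (φ x) :=
      hx ▸ hcM.mdifferentiableAt one_ne_zero
    exact (h1.comp x hφ).differentiableAt
  have hstrict := hψc.hasStrictFDerivAt one_ne_zero
  set A := fderiv ℝ (c ∘ ψ) (θ x) with hA
  have hAinj : Function.Injective A := by
    have h1 : A = (mfderiv (𝓡 n) 𝓘(ℝ, EuclideanSpace ℝ (Fin n)) c (ψ (θ x))).comp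
        (mfderiv (𝓡 k) (𝓡 n) ψ (θ x)) := by
      rw [hA, ← mfderiv_eq_fderiv]
      exact mfderiv_comp _ (hcM.mdifferentiableAt one_ne_zero) (hψ.mdifferentiableAt one_ne_zero)
    have h2 : Function.Injective
        (mfderiv (𝓡 n) 𝓘(ℝ, EuclideanSpace ℝ (Fin n)) c (ψ (θ x))) :=
      (isInvertible_mfderiv_extChartAt (mem_extChartAt_source (I := 𝓡 n) (ψ (θ x)))).injective
    rw [h1]
    exact h2.comp hinj
  -- With a left inverse `L` of `A`, the map `L ∘ c ∘ ψ` has identity derivative and is locally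
  -- invertible. Near `x`, `θ` is this inverse applied to `L ∘ c ∘ φ`; continuity of `θ` keeps it in
  -- the domain of the inverse.
  obtain ⟨L, hL⟩ := A.toLinearMap.exists_leftInverse_of_injective
    (LinearMap.ker_eq_bot.2 hAinj)
  have hF : HasStrictFDerivAt (fun u => L.toContinuousLinearMap (c (ψ u)))
      ((ContinuousLinearEquiv.refl ℝ (EuclideanSpace ℝ (Fin k))) :
        EuclideanSpace ℝ (Fin k) →L[ℝ] EuclideanSpace ℝ (Fin k)) (θ x) := by
    have h1 := L.toContinuousLinearMap.hasStrictFDerivAt.comp (θ x) hstrict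
    convert! h1 using 1
    ext1 v
    exact (LinearMap.congr_fun hL v).symm
  have hinv := hF.to_localInverse.differentiableAt
  have h2 : DifferentiableAt ℝ (fun x' => L.toContinuousLinearMap (c (φ x'))) x :=
    L.toContinuousLinearMap.differentiableAt.comp x hφc
  have h3 : θ =ᶠ[𝓝 x] fun x' => hF.localInverse _ _ _ (L.toContinuousLinearMap (c (φ x'))) := by
    filter_upwards [hθ.eventually hF.eventually_left_inverse, h] with x' h4 h5
    rw [← h5]
    exact h4.symm
  refine DifferentiableAt.congr_of_eventuallyEq ?_ h3
  refine DifferentiableAt.comp x ?_ h2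
  rw [← hx]
  exact hinv

end Immersion

namespace Foliation

variable {n k : ℕ} {M : Type*} [TopologicalSpace M]
  [ChartedSpace (EuclideanSpace ℝ (Fin n)) M] [IsManifold (𝓡 n) ∞ M] (W : Foliation n k M)

/-- The expression, in plaques of two boxes, of a map preserving the leaves. -/
noncomputable def transition (g : M → M) (p q : M) (y : EuclideanSpace ℝ (Fin (n - k)))
    (x : EuclideanSpace ℝ (Fin k)) : EuclideanSpace ℝ (Fin k) :=
  ((W.boxHomeo q).symm (g (W.box p (x, y)))).1

section transition

variable {W} {g : M → M} {p q : M} {y v : EuclideanSpace ℝ (Fin (n - k))}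
  {x u : EuclideanSpace ℝ (Fin k)}

lemma transition_eq (h : g (W.box p (x, y)) = W.box q (u, v)) : W.transition g p q y x = u := by
  rw [transition, h, boxHomeo_symm_box]

lemma box_transition (h : ∃ u, g (W.box p (x, y)) = W.box q (u, v)) :
    W.box q (W.transition g p q y x, v) = g (W.box p (x, y)) := by
  obtain ⟨u, hu⟩ := h
  rw [transition_eq hu, hu]

variable [CompactSpace M]

lemma eventuallyEq_transition (hg : Continuous g)
    (hW : ∀ a, g '' W.leaf a ⊆ W.leaf (g a)) (h : ∃ u, g (W.box p (x, y)) = W.box q (u, v)) :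
    (fun x => W.box q (x, v)) ∘ W.transition g p q y =ᶠ[𝓝 x] fun x => g (W.box p (x, y)) := by
  obtain ⟨u, hu⟩ := h
  filter_upwards [W.eventually_mem_plaque hg hW hu] with x' hx'
  exact box_transition hx'

lemma differentiableAt_transition (hg : ContMDiff (𝓡 n) (𝓡 n) 1 g)
    (hW : ∀ a, g '' W.leaf a ⊆ W.leaf (g a)) (h : ∃ u, g (W.box p (x, y)) = W.box q (u, v)) :
    DifferentiableAt ℝ (W.transition g p q y) x := by
  have hgx : g (W.box p (x, y)) ∈ range (W.box q) := by
    obtain ⟨u, hu⟩ := h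
    exact ⟨_, hu.symm⟩
  refine differentiableAt_of_comp_immersion (W.contMDiff_plaque q v).contMDiffAt
    (W.injective_mfderiv_plaque q _ v)
    (((hg.comp (W.contMDiff_plaque p y)).mdifferentiable one_ne_zero) x) ?_
    (eventuallyEq_transition hg.continuous hW h)
  have h1 : ContinuousAt (W.boxHomeo q).symm (g (W.box p (x, y))) :=
    (W.continuousOn_boxHomeo_symm q).continuousAt
      ((W.isOpenEmbedding_box q).isOpen_range.mem_nhds hgx)
  exact continuous_fst.continuousAt.comp
    (ContinuousAt.comp (f := fun x => g (W.box p (x, y))) h1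
      (hg.continuous.comp (W.continuous_plaque p y)).continuousAt)

/-- The chain rule for the transition maps between plaques. -/
lemma mfderiv_comp_transition (hg : ContMDiff (𝓡 n) (𝓡 n) 1 g)
    (hW : ∀ a, g '' W.leaf a ⊆ W.leaf (g a)) (h : ∃ u, g (W.box p (x, y)) = W.box q (u, v)) :
    mfderiv (𝓡 k) (𝓡 n) ((fun x => W.box q (x, v)) ∘ W.transition g p q y) x =
      (mfderiv (𝓡 k) (𝓡 n) (fun x => W.box q (x, v)) (W.transition g p q y x)).comp
        (mfderiv (𝓡 k) (𝓡 k) (W.transition g p q y) x) :=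
  mfderiv_comp _ (((W.contMDiff_plaque q v).mdifferentiable one_ne_zero) _)
    (differentiableAt_transition hg hW h).mdifferentiableAt

end transition

/-- Every tangent space is the model space `ℝ^n` by definition, so the cast along `box_zero` in
`tangent` becomes invisible there. -/
lemma tangent_eq_range (a : M) :
    (W.tangent a : Submodule ℝ (EuclideanSpace ℝ (Fin n))) =
      LinearMap.range (W.plaqueDeriv a 0 0 :
        EuclideanSpace ℝ (Fin k) →ₗ[ℝ] EuclideanSpace ℝ (Fin n)) := by
  have key : ∀ (b c : M) (h : b = c) (S : Submodule ℝ (TangentSpace (𝓡 n) b)),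
      ((h ▸ S : Submodule ℝ (TangentSpace (𝓡 n) c)) :
        Submodule ℝ (EuclideanSpace ℝ (Fin n))) = S := by
    rintro b _ rfl S
    rfl
  exact key _ _ (W.box_zero a) _

/-- The tangent space of a leaf can be computed in any box. -/
lemma tangent_box [CompactSpace M] (p : M) (x : EuclideanSpace ℝ (Fin k))
    (y : EuclideanSpace ℝ (Fin (n - k))) :
    W.tangent (W.box p (x, y)) = LinearMap.range (W.plaqueDeriv p x y) := by
  set a := W.box p (x, y) with ha
  -- The identity preserves leaves, so its transition map compares the central plaque at `a` with
  -- the given plaque.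
  have h : ∃ u, id (W.box a (0, 0)) = W.box p (u, y) := ⟨x, W.box_zero a⟩
  have hid : ∀ b, id '' W.leaf b ⊆ W.leaf (id b) := fun b => by simp
  have hx : W.transition id a p 0 0 = x := transition_eq (W.box_zero a)
  have h1 := mfderiv_comp_transition contMDiff_id hid h
  have h2 := (eventuallyEq_transition continuous_id hid h).mfderiv_eq (I := 𝓡 k) (I' := 𝓡 n)
  rw [h1, hx] at h2
  have h3 : (W.plaqueDeriv a 0 0 : EuclideanSpace ℝ (Fin k) →ₗ[ℝ] EuclideanSpace ℝ (Fin n)) =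
      (W.plaqueDeriv p x y : EuclideanSpace ℝ (Fin k) →ₗ[ℝ] EuclideanSpace ℝ (Fin n)) ∘ₗ
        (mfderiv (𝓡 k) (𝓡 k) (W.transition id a p 0) 0).toLinearMap :=
    (congrArg ContinuousLinearMap.toLinearMap h2).symm
  have hi : ∀ b z w, Function.Injective
      (W.plaqueDeriv b z w : EuclideanSpace ℝ (Fin k) →ₗ[ℝ] EuclideanSpace ℝ (Fin n)) :=
    fun b z w => W.injective_mfderiv_plaque b z w
  exact (W.tangent_eq_range a).trans
    (LinearMap.range_eq_of_eq_comp_injective h3 (hi a 0 0) (hi p x y))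

end Foliation

/-! ### Volume densities and the leafwise Jacobian -/

section VolDensity

variable {n k : ℕ} {M : Type*} [TopologicalSpace M]
  [ChartedSpace (EuclideanSpace ℝ (Fin n)) M]
  [RiemannianBundle (fun x : M => TangentSpace (𝓡 n) x)]

/-- The `k`-dimensional volume density of a map from `ℝ^k` to a Riemannian manifold. -/
noncomputable def volDensity (F : EuclideanSpace ℝ (Fin k) → M) (x : EuclideanSpace ℝ (Fin k)) :
    ℝ :=
  LinearMap.normDet (U := EuclideanSpace ℝ (Fin k)) (V := TangentSpace (𝓡 n) (F x))
    (mfderiv (𝓡 k) (𝓡 n) F x).toLinearMap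

lemma volDensity_nonneg (F : EuclideanSpace ℝ (Fin k) → M) (x : EuclideanSpace ℝ (Fin k)) :
    0 ≤ volDensity (n := n) F x := LinearMap.normDet_nonneg _

lemma volDensity_pos {F : EuclideanSpace ℝ (Fin k) → M} {x : EuclideanSpace ℝ (Fin k)}
    (h : Function.Injective (mfderiv (𝓡 k) (𝓡 n) F x)) : 0 < volDensity (n := n) F x := by
  refine lt_of_le_of_ne (volDensity_nonneg F x) fun h0 => ?_
  refine LinearMap.normDet_eq_zero_iff_ker_ne_bot.1 h0.symm ?_
  exact LinearMap.ker_eq_bot.2 h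

/-- The norm used depends on the base point, so the values and the derivatives have to be exchanged
together. -/
lemma volDensity_congr {F G : EuclideanSpace ℝ (Fin k) → M} {x : EuclideanSpace ℝ (Fin k)}
    (h : F =ᶠ[𝓝 x] G) : volDensity (n := n) F x = volDensity (n := n) G x := by
  have key : ∀ (a b : M) (_ : a = b) (A B : EuclideanSpace ℝ (Fin k) →ₗ[ℝ] EuclideanSpace ℝ (Fin n))
      (_ : A = B),
      LinearMap.normDet (U := EuclideanSpace ℝ (Fin k)) (V := TangentSpace (𝓡 n) a) A =
      LinearMap.normDet (U := EuclideanSpace ℝ (Fin k)) (V := TangentSpace (𝓡 n) b) B := by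
    rintro a _ rfl A _ rfl
    rfl
  exact key _ _ h.eq_of_nhds _ _
    (congrArg ContinuousLinearMap.toLinearMap (h.mfderiv_eq (I := 𝓡 k) (I' := 𝓡 n)))

lemma volDensity_comp_right {F : EuclideanSpace ℝ (Fin k) → M}
    {θ : EuclideanSpace ℝ (Fin k) → EuclideanSpace ℝ (Fin k)} {x : EuclideanSpace ℝ (Fin k)}
    (hF : MDifferentiableAt (𝓡 k) (𝓡 n) F (θ x)) (hθ : DifferentiableAt ℝ θ x) :
    volDensity (n := n) (F ∘ θ) x = |(fderiv ℝ θ x).det| * volDensity (n := n) F (θ x) := by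
  have h1 : mfderiv (𝓡 k) (𝓡 n) (F ∘ θ) x = (mfderiv (𝓡 k) (𝓡 n) F (θ x)).comp
      (mfderiv (𝓡 k) (𝓡 k) θ x) := mfderiv_comp x hF hθ.mdifferentiableAt
  have h2 := LinearMap.normDet_comp_of_finrank_eq (𝕜 := ℝ) (V := EuclideanSpace ℝ (Fin k))
    (fderiv ℝ θ x).toLinearMap
    (LinearMap.id (R := ℝ) (M := TangentSpace (𝓡 n) (F (θ x))) ∘ₗ
      (mfderiv (𝓡 k) (𝓡 n) F (θ x)).toLinearMap) rfl
  rw [LinearMap.normDet_eq_abs_det] at h2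
  rw [mul_comm]
  refine Eq.trans ?_ h2
  have h3 := congrArg ContinuousLinearMap.toLinearMap h1
  rw [mfderiv_eq_fderiv] at h3
  exact congrArg (LinearMap.normDet (U := EuclideanSpace ℝ (Fin k))
    (V := TangentSpace (𝓡 n) (F (θ x)))) h3

variable [IsManifold (𝓡 n) ∞ M] [IsContMDiffRiemannianBundle (𝓡 n) ∞ (EuclideanSpace ℝ (Fin n))
      (fun x : M => TangentSpace (𝓡 n) x)]

instance : IsContinuousRiemannianBundle (EuclideanSpace ℝ (Fin n))
    (fun x : M => TangentSpace (𝓡 n) x) := by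
  obtain ⟨g, hg, h⟩ := IsContMDiffRiemannianBundle.exists_contMDiff (IB := 𝓡 n) (n := ∞)
    (F := EuclideanSpace ℝ (Fin n)) (E := fun x : M => TangentSpace (𝓡 n) x)
  exact ⟨g, hg.continuous, h⟩

/-- The density is the square root of the Gram determinant of the image of an orthonormal basis, and
the metric is continuous. -/
lemma continuous_volDensity {Z : Type*} [TopologicalSpace Z]
    {F : Z → EuclideanSpace ℝ (Fin k) → M} {u : Z → EuclideanSpace ℝ (Fin k)}
    (h : ∀ w : EuclideanSpace ℝ (Fin k), Continuous fun z =>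
      (⟨F z (u z), mfderiv (𝓡 k) (𝓡 n) (F z) (u z) w⟩ : TangentBundle (𝓡 n) M)) :
    Continuous fun z => volDensity (n := n) (F z) (u z) := by
  have h1 : ∀ z, volDensity (n := n) (F z) (u z) = √(Matrix.det fun i j =>
      inner ℝ (E := TangentSpace (𝓡 n) (F z (u z)))
        (mfderiv (𝓡 k) (𝓡 n) (F z) (u z) (EuclideanSpace.basisFun (Fin k) ℝ i))
        (mfderiv (𝓡 k) (𝓡 n) (F z) (u z) (EuclideanSpace.basisFun (Fin k) ℝ j))) := by
    intro z
    have h2 := LinearMap.normDet_sq_eq_det_gram (𝕜 := ℝ) (U := EuclideanSpace ℝ (Fin k))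
      (V := TangentSpace (𝓡 n) (F z (u z))) (mfderiv (𝓡 k) (𝓡 n) (F z) (u z)).toLinearMap
      (EuclideanSpace.basisFun (Fin k) ℝ)
    rw [← Real.sqrt_sq (volDensity_nonneg (F z) (u z))]
    exact congrArg Real.sqrt h2
  simp_rw [h1]
  refine Real.continuous_sqrt.comp (Continuous.matrix_det (continuous_matrix fun i j => ?_))
  exact Continuous.inner_bundle (F := EuclideanSpace ℝ (Fin n)) (h _) (h _)

end VolDensity

namespace Foliation

variable {n k : ℕ} {M : Type*} [TopologicalSpace M]
  [ChartedSpace (EuclideanSpace ℝ (Fin n)) M] [IsManifold (𝓡 n) ∞ M] (W : Foliation n k M)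
  [RiemannianBundle (fun x : M => TangentSpace (𝓡 n) x)]

lemma volDensity_box_pos (p : M) (x : EuclideanSpace ℝ (Fin k))
    (y : EuclideanSpace ℝ (Fin (n - k))) :
    0 < volDensity (n := n) (fun u => W.box p (u, y)) x :=
  volDensity_pos (W.injective_mfderiv_plaque p x y)

lemma leafJacobian_pos {g : M → M} {a : M} (hinj : Function.Injective (mfderiv (𝓡 n) (𝓡 n) g a)) : 0 < W.leafJacobian g a := by
  refine lt_of_le_of_ne (LinearMap.normDet_nonneg _) fun h0 => ?_
  refine LinearMap.normDet_eq_zero_iff_ker_ne_bot.1 h0.symm (LinearMap.ker_eq_bot.2 ?_)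
  exact hinj.comp Subtype.val_injective

section
variable [CompactSpace M]

/-- By `tangent_box` the plane `T W` is the range of `plaqueDeriv`, so this is multiplicativity of
`normDet`. It lets Jacobians be computed as quotients of densities. -/
lemma volDensity_comp_box {g : M → M} {p : M} {x : EuclideanSpace ℝ (Fin k)}
    {y : EuclideanSpace ℝ (Fin (n - k))}
    (hg : MDifferentiableAt (𝓡 n) (𝓡 n) g (W.box p (x, y))) :
    volDensity (n := n) (fun u => g (W.box p (u, y))) x =
      W.leafJacobian g (W.box p (x, y)) * volDensity (n := n) (fun u => W.box p (u, y)) x := by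
  have h1 : mfderiv (𝓡 k) (𝓡 n) (fun u => g (W.box p (u, y))) x =
      (mfderiv (𝓡 n) (𝓡 n) g (W.box p (x, y))).comp
        (mfderiv (𝓡 k) (𝓡 n) (fun u => W.box p (u, y)) x) :=
    mfderiv_comp x hg (((W.contMDiff_plaque p y).mdifferentiable one_ne_zero) x)
  have h2 := LinearMap.normDet_comp (W.plaqueDeriv p x y)
    (mfderiv (𝓡 n) (𝓡 n) g (W.box p (x, y))).toLinearMap
  have key : ∀ (S T : Submodule ℝ (TangentSpace (𝓡 n) (W.box p (x, y)))) [FiniteDimensional ℝ S]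
      [FiniteDimensional ℝ T] (_ : S = T),
      ((mfderiv (𝓡 n) (𝓡 n) g (W.box p (x, y))).toLinearMap.domRestrict S).normDet =
      ((mfderiv (𝓡 n) (𝓡 n) g (W.box p (x, y))).toLinearMap.domRestrict T).normDet := by
    rintro S _ _ _ rfl
    rfl
  have h3 := key _ _ (W.tangent_box p x y)
  refine Eq.trans ?_ (h2.trans ?_)
  · exact congrArg (fun A : EuclideanSpace ℝ (Fin k) →L[ℝ] EuclideanSpace ℝ (Fin n) =>
      LinearMap.normDet (U := EuclideanSpace ℝ (Fin k))
      (V := TangentSpace (𝓡 n) (g (W.box p (x, y)))) A.toLinearMap) h1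
  · rw [← h3]
    rfl

/-- The chain rule for the leafwise Jacobian. -/
lemma leafJacobian_comp {g h : M → M} (hg : ContMDiff (𝓡 n) (𝓡 n) 1 g)
    (hh : ContMDiff (𝓡 n) (𝓡 n) 1 h) (hW : ∀ a, h '' W.leaf a ⊆ W.leaf (h a)) (a : M) :
    W.leafJacobian (g ∘ h) a = W.leafJacobian g (h a) * W.leafJacobian h a := by
  set b := h a with hb
  have hex : ∃ u, h (W.box a (0, 0)) = W.box b (u, 0) := ⟨0, by rw [W.box_zero, W.box_zero]⟩
  have hθ0 : W.transition h a b 0 0 = 0 := transition_eq (by rw [W.box_zero, W.box_zero])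
  have hev := eventuallyEq_transition hh.continuous hW hex
  have hθ := differentiableAt_transition hh hW hex
  have hpl := fun p (y : EuclideanSpace ℝ (Fin (n - k))) =>
    (W.contMDiff_plaque p y).mdifferentiable one_ne_zero
  -- The density of `g ∘ h` on the central plaque at `a` is computed directly and through the
  -- transition map to the box at `b`. The determinant of the transition map accounts for `h`, and
  -- the positive density at `a` cancels.
  have e1 := W.volDensity_comp_box (p := a) (x := 0) (y := 0)
    ((hg.comp hh).mdifferentiable one_ne_zero _)
  have e2 := W.volDensity_comp_box (p := a) (x := 0) (y := 0) (hh.mdifferentiable one_ne_zero _)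
  have e3 := W.volDensity_comp_box (p := b) (x := 0) (y := 0) (hg.mdifferentiable one_ne_zero _)
  have e4 := volDensity_comp_right (n := n) (F := fun u => W.box b (u, 0)) (hpl b 0 _) hθ
  have e5 := volDensity_comp_right (n := n) (F := fun u => g (W.box b (u, 0)))
    (((hg.comp (W.contMDiff_plaque b 0)).mdifferentiable one_ne_zero) _) hθ
  rw [volDensity_congr (n := n) hev] at e4
  have hev2 : (fun u => g (W.box b (u, 0))) ∘ W.transition h a b 0 =ᶠ[𝓝 0]
      fun u => (g ∘ h) (W.box a (u, 0)) := by
    filter_upwards [hev] with u hu using congrArg g hu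
  rw [volDensity_congr (n := n) hev2] at e5
  rw [hθ0] at e4 e5
  rw [W.box_zero] at e1 e2 e3
  have hp := W.volDensity_box_pos a 0 0
  refine mul_right_cancel₀ hp.ne' ?_
  rw [← e1, e5, e3, mul_assoc, ← e2, e4]
  ring

variable [IsContMDiffRiemannianBundle (𝓡 n) ∞ (EuclideanSpace ℝ (Fin n))
      (fun x : M => TangentSpace (𝓡 n) x)]

/-- In a box the Jacobian is a quotient of two continuous densities with nonvanishing denominator.
-/
lemma continuous_leafJacobian {g : M → M} (hg : ContMDiff (𝓡 n) (𝓡 n) 1 g) :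
    Continuous (W.leafJacobian g) := by
  rw [continuous_iff_continuousAt]
  intro p
  have h1 : Continuous fun z : EuclideanSpace ℝ (Fin k) × EuclideanSpace ℝ (Fin (n - k)) =>
      volDensity (n := n) (fun u => W.box p (u, z.2)) z.1 :=
    continuous_volDensity (n := n) (F := fun z u => W.box p (u, z.2)) (u := Prod.fst)
      fun w => W.continuous_mfderiv_plaque p w
  have h2 : Continuous fun z : EuclideanSpace ℝ (Fin k) × EuclideanSpace ℝ (Fin (n - k)) =>
      volDensity (n := n) (fun u => g (W.box p (u, z.2))) z.1 := by
    refine continuous_volDensity (n := n) (F := fun z u => g (W.box p (u, z.2))) (u := Prod.fst)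
      fun w => ?_
    have h3 := (hg.continuous_tangentMap le_rfl).comp (W.continuous_mfderiv_plaque p w)
    convert! h3 using 2 with z
    have h4 : mfderiv (𝓡 k) (𝓡 n) (fun u => g (W.box p (u, z.2))) z.1 =
        (mfderiv (𝓡 n) (𝓡 n) g (W.box p (z.1, z.2))).comp
        (mfderiv (𝓡 k) (𝓡 n) (fun u => W.box p (u, z.2)) z.1) :=
      mfderiv_comp z.1 (hg.mdifferentiable one_ne_zero _)
        (((W.contMDiff_plaque p z.2).mdifferentiable one_ne_zero) z.1)
    rw [h4]
    rfl
  have h5 : Continuous (W.leafJacobian g ∘ W.box p) := by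
    refine (h2.div h1 fun z => (W.volDensity_box_pos p z.1 z.2).ne').congr fun z => ?_
    rw [Pi.div_apply, W.volDensity_comp_box (hg.mdifferentiable one_ne_zero _)]
    exact mul_div_cancel_right₀ _ (W.volDensity_box_pos p z.1 z.2).ne'
  have h6 := (W.isOpenEmbedding_box p).continuousAt_iff.1 (h5.continuousAt (x := (0, 0)))
  rwa [W.box_zero] at h6

end

end Foliation

/-! ### Lower bounds for leaf volume; small plaques inside leaf disks -/

namespace Foliation

variable {n k : ℕ} {M : Type*} [TopologicalSpace M]
  [ChartedSpace (EuclideanSpace ℝ (Fin n)) M] [IsManifold (𝓡 n) ∞ M] (W : Foliation n k M)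
  [RiemannianBundle (fun x : M => TangentSpace (𝓡 n) x)]

section LeafVolume

variable [CompactSpace M] {g : M → M}

/-- Change of variables for the transition map `θ`, injective because `g` is. The set `S` is
arbitrary, as in the covers defining `leafVolume`, so its preimage is replaced by the measurable
hull `H`. -/
lemma setLIntegral_volDensity_le (hg : ContMDiff (𝓡 n) (𝓡 n) 1 g) (hinj : Function.Injective g)
    (hW : ∀ a, g '' W.leaf a ⊆ W.leaf (g a)) (p q : M) (y v : EuclideanSpace ℝ (Fin (n - k)))
    {S : Set M} (hS : S ⊆ range fun u => W.box q (u, v)) :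
    ∃ E', MeasurableSet E' ∧ (fun x => g (W.box p (x, y))) ⁻¹' S ⊆ E' ∧
      ∫⁻ x in E', ENNReal.ofReal (volDensity (n := n) (fun u => g (W.box p (u, y))) x) ≤
      ∫⁻ u in (fun u => W.box q (u, v)) ⁻¹' S,
        ENNReal.ofReal (volDensity (n := n) (fun u => W.box q (u, v)) u) := by
  set θ := W.transition g p q y with hθ
  set H := toMeasurable volume ((fun u => W.box q (u, v)) ⁻¹' S) with hH
  set Ω := {x | ∃ u, g (W.box p (x, y)) = W.box q (u, v)} with hΩ
  have hΩo : IsOpen Ω := isOpen_iff_eventually.2 fun x ⟨u, hu⟩ =>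
    W.eventually_mem_plaque hg.continuous hW hu
  have hdiff : ∀ x ∈ Ω, DifferentiableAt ℝ θ x := fun x hx =>
    differentiableAt_transition hg hW hx
  have hcont : ContinuousOn θ Ω := fun x hx => (hdiff x hx).continuousAt.continuousWithinAt
  have hE' : MeasurableSet (Ω ∩ θ ⁻¹' H) := by
    have h1 := (hcont.domRestrict.measurable (measurableSet_toMeasurable volume
      ((fun u => W.box q (u, v)) ⁻¹' S)))
    have h2 := hΩo.measurableSet.subtype_image h1
    convert h2 using 1
    ext x
    simp [hH, and_comm]
  have hθinj : InjOn θ (Ω ∩ θ ⁻¹' H) := by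
    intro x hx x' hx' h
    have h1 := box_transition hx.1
    have h2 := box_transition hx'.1
    rw [← hθ, h, hθ, h2] at h1
    exact (congrArg Prod.fst (W.injective_box p (hinj h1))).symm
  refine ⟨Ω ∩ θ ⁻¹' H, hE', ?_, ?_⟩
  · intro x hx
    obtain ⟨u, hu⟩ := hS hx
    refine ⟨⟨u, hu.symm⟩, subset_toMeasurable _ _ ?_⟩
    change W.box q (W.transition g p q y x, v) ∈ S
    rw [box_transition ⟨u, hu.symm⟩]
    exact hx
  · calc ∫⁻ x in Ω ∩ θ ⁻¹' H,
          ENNReal.ofReal (volDensity (n := n) (fun u => g (W.box p (u, y))) x)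
        = ∫⁻ x in Ω ∩ θ ⁻¹' H, ENNReal.ofReal |(fderiv ℝ θ x).det| *
          ENNReal.ofReal (volDensity (n := n) (fun u => W.box q (u, v)) (θ x)) := by
          refine setLIntegral_congr_fun hE' fun x hx => ?_
          have h1 := volDensity_comp_right (n := n) (F := fun u => W.box q (u, v))
            (((W.contMDiff_plaque q v).mdifferentiable one_ne_zero) _) (hdiff x hx.1)
          rw [volDensity_congr (n := n) (eventuallyEq_transition hg.continuous hW hx.1)] at h1
          simp only [h1, ENNReal.ofReal_mul (abs_nonneg _)]
      _ = ∫⁻ u in θ '' (Ω ∩ θ ⁻¹' H),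
          ENNReal.ofReal (volDensity (n := n) (fun u => W.box q (u, v)) u) :=
          (lintegral_image_eq_lintegral_abs_det_fderiv_mul volume hE'
            (fun x hx => (hdiff x hx.1).hasFDerivAt.hasFDerivWithinAt) hθinj (fun u =>
              ENNReal.ofReal (volDensity (n := n) (fun u => W.box q (u, v)) u))).symm
      _ ≤ ∫⁻ u in H, ENNReal.ofReal (volDensity (n := n) (fun u => W.box q (u, v)) u) :=
          lintegral_mono_set (by rintro _ ⟨x, hx, rfl⟩; exact hx.2)
      _ = _ := by rw [hH, Measure.restrict_toMeasurable_of_sFinite]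

/-- Lower bound for the leaf volume of the image of a set in a plaque. -/
lemma setLIntegral_volDensity_le_leafVolume (hg : ContMDiff (𝓡 n) (𝓡 n) 1 g)
    (hinj : Function.Injective g) (hW : ∀ a, g '' W.leaf a ⊆ W.leaf (g a)) (p : M)
    (y : EuclideanSpace ℝ (Fin (n - k))) {E : Set (EuclideanSpace ℝ (Fin k))} {T : Set M}
    (hT : MapsTo (fun x => g (W.box p (x, y))) E T) :
    ∫⁻ x in E, ENNReal.ofReal (volDensity (n := n) (fun u => g (W.box p (u, y))) x) ≤
      W.leafVolume T := by
  set D : EuclideanSpace ℝ (Fin k) → ℝ≥0∞ := fun x =>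
    ENNReal.ofReal (volDensity (n := n) (fun u => g (W.box p (u, y))) x) with hD
  set m := (volume.restrict E).withDensity D with hm
  -- Since `boundedBy` yields the largest outer measure below the one-plaque formula, the
  -- pushforward of `m` need only be compared on sets lying in one plaque.
  have hle : OuterMeasure.map (fun x => g (W.box p (x, y))) m.toOuterMeasure ≤ W.leafVolume := by
    refine OuterMeasure.le_boundedBy.2 fun S => ?_
    refine le_iInf fun q => le_iInf fun v => le_iInf fun hS => ?_
    obtain ⟨E', hE', hsub, hle⟩ := W.setLIntegral_volDensity_le hg hinj hW p q y v hS
    rw [OuterMeasure.map_apply]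
    calc m ((fun x => g (W.box p (x, y))) ⁻¹' S) ≤ m E' := measure_mono hsub
      _ = ∫⁻ x in E', D x ∂(volume.restrict E) := withDensity_apply _ hE'
      _ ≤ ∫⁻ x in E', D x := lintegral_mono' (Measure.restrict_mono_measure
          Measure.restrict_le_self _) le_rfl
      _ ≤ _ := hle
  have h1 := hle T
  rw [OuterMeasure.map_apply] at h1
  refine le_trans ?_ h1
  refine le_trans ?_ (measure_mono (μ := m) (s := E) hT)
  calc ∫⁻ x in E, D x = ∫⁻ x in E, D x ∂(volume.restrict E) := by
        rw [Measure.restrict_restrict_of_subset Subset.rfl]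
    _ ≤ m E := withDensity_apply_le _ _

end LeafVolume

section LeafDisk

variable [IsContMDiffRiemannianBundle (𝓡 n) ∞ (EuclideanSpace ℝ (Fin n))
      (fun x : M => TangentSpace (𝓡 n) x)]

lemma continuous_norm_mfderiv_plaque (p : M) (y : EuclideanSpace ℝ (Fin (n - k)))
    (w : EuclideanSpace ℝ (Fin k)) :
    Continuous fun z : EuclideanSpace ℝ (Fin k) =>
      ‖(W.plaqueDeriv p z y w : TangentSpace (𝓡 n) (W.box p (z, y)))‖ := by
  have h1 : Continuous fun z : EuclideanSpace ℝ (Fin k) =>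
      (⟨W.box p (z, y), W.plaqueDeriv p z y w⟩ : TangentBundle (𝓡 n) M) :=
    (W.continuous_mfderiv_plaque p w).comp (f := fun z => (z, y)) (by fun_prop)
  have h2 := Continuous.inner_bundle (F := EuclideanSpace ℝ (Fin n))
    (E := fun x : M => TangentSpace (𝓡 n) x) h1 h1
  refine (Real.continuous_sqrt.comp h2).congr fun z => ?_
  exact (norm_eq_sqrt_real_inner _).symm

/-- A small plaque around a point is contained in the leaf disk. -/
lemma exists_ball_subset_leafDisk (p : M) (x : EuclideanSpace ℝ (Fin k))
    (y : EuclideanSpace ℝ (Fin (n - k))) {ρ : ℝ} (hρ : 0 < ρ) :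
    ∃ δ > 0, ∀ x' ∈ Metric.ball x δ, W.box p (x', y) ∈ W.leafDisk (W.box p (x, y)) ρ := by
  let e := EuclideanSpace.basisFun (Fin k) ℝ
  let C : EuclideanSpace ℝ (Fin k) → ℝ := fun z =>
    ∑ i, ‖(W.plaqueDeriv p z y (e i) : TangentSpace (𝓡 n) (W.box p (z, y)))‖
  have hC : Continuous C := continuous_finsetSum _ fun i _ =>
    W.continuous_norm_mfderiv_plaque p y (e i)
  have hC0 : ∀ z, 0 ≤ C z := fun z => Finset.sum_nonneg fun i _ => norm_nonneg _
  have hbound : ∀ z w, ‖(W.plaqueDeriv p z y w : TangentSpace (𝓡 n) (W.box p (z, y)))‖ ≤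
      ‖w‖ * C z := by
    intro z w
    conv_lhs => rw [← e.sum_repr w, map_sum]
    refine (norm_sum_le _ _).trans ?_
    rw [Finset.mul_sum]
    refine Finset.sum_le_sum fun i _ => ?_
    rw [map_smul, norm_smul]
    refine mul_le_mul_of_nonneg_right ?_ (norm_nonneg _)
    have h1 := (PiLp.norm_apply_le (e.repr w) i)
    simpa using h1
  obtain ⟨δ₀, hδ₀, hball⟩ := Metric.mem_nhds_iff.1
    (hC.continuousAt.eventually_lt continuousAt_const (show C x < C x + 1 by linarith))
  set K := C x + 1 with hK
  have hKpos : 0 < K := by linarith [hC0 x]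
  -- The first radius keeps the derivative of the plaque bounded by `K`; the second makes the image
  -- of the straight segment shorter than `ρ`.
  refine ⟨min δ₀ (ρ / K), by positivity, fun x' hx' => ?_⟩
  rw [Metric.mem_ball, lt_min_iff] at hx'
  set γ₀ : ℝ → EuclideanSpace ℝ (Fin k) := fun t => x + t • (x' - x) with hγ₀
  have hγ₀c : ContDiff ℝ 1 γ₀ := by fun_prop
  have hγ₀d : ∀ t, HasDerivAt γ₀ (x' - x) t := fun t => by
    have h1 := ((hasDerivAt_id t).smul_const (x' - x)).const_add x
    rwa [one_smul] at h1
  set γ : ℝ → M := fun t => W.box p (γ₀ t, y) with hγ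
  have hγc : ContMDiff 𝓘(ℝ, ℝ) (𝓡 n) 1 γ := (W.contMDiff_plaque p y).comp hγ₀c.contMDiff
  have hder : ∀ t, mfderiv 𝓘(ℝ, ℝ) (𝓡 n) γ t 1 = W.plaqueDeriv p (γ₀ t) y (x' - x) := by
    intro t
    have h1 : mfderiv 𝓘(ℝ, ℝ) (𝓡 n) γ t =
        (mfderiv (𝓡 k) (𝓡 n) (fun u => W.box p (u, y)) (γ₀ t)).comp
          (mfderiv 𝓘(ℝ, ℝ) (𝓡 k) γ₀ t) :=
      mfderiv_comp t (((W.contMDiff_plaque p y).mdifferentiable one_ne_zero) _)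
        (hγ₀d t).differentiableAt.mdifferentiableAt
    have h2 : mfderiv 𝓘(ℝ, ℝ) (𝓡 k) γ₀ t (1 : ℝ) = x' - x := by
      rw [mfderiv_eq_fderiv, (hγ₀d t).hasFDerivAt.fderiv]
      exact one_smul ℝ (x' - x)
    rw [h1]
    exact congrArg (W.plaqueDeriv p (γ₀ t) y) h2
  have hlen : pathELength (𝓡 n) γ 0 1 ≤ ENNReal.ofReal (‖x' - x‖ * K) := by
    rw [pathELength_eq_lintegral_mfderiv_Icc]
    calc ∫⁻ t in Icc (0 : ℝ) 1, ‖mfderiv 𝓘(ℝ, ℝ) (𝓡 n) γ t 1‖ₑ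
        ≤ ∫⁻ t in Icc (0 : ℝ) 1, ENNReal.ofReal (‖x' - x‖ * K) := by
          refine setLIntegral_mono measurable_const fun t ht => ?_
          rw [hder t, ← ofReal_norm]
          refine ENNReal.ofReal_le_ofReal ((hbound _ _).trans ?_)
          refine mul_le_mul_of_nonneg_left (le_of_lt (hball ?_)) (norm_nonneg _)
          rw [Metric.mem_ball, dist_eq_norm, hγ₀]
          simp only [add_sub_cancel_left, norm_smul, Real.norm_eq_abs, abs_of_nonneg ht.1]
          refine lt_of_le_of_lt (mul_le_of_le_one_left (norm_nonneg _) ht.2) ?_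
          rw [← dist_eq_norm]
          exact hx'.1
      _ = ENNReal.ofReal (‖x' - x‖ * K) := by simp
  have hlt : ENNReal.ofReal (‖x' - x‖ * K) < ENNReal.ofReal ρ := by
    rw [ENNReal.ofReal_lt_ofReal_iff hρ, ← lt_div_iff₀ hKpos, ← dist_eq_norm]
    exact hx'.2
  refine lt_of_le_of_lt ?_ hlt
  refine le_trans ?_ hlen
  have h0 : γ 0 = W.box p (x, y) := by simp [hγ, hγ₀]
  have h1 : γ 1 = W.box p (x', y) := by simp [hγ, hγ₀]
  exact iInf_le_of_le γ (iInf_le_of_le hγc.contMDiffOn (iInf_le_of_le h0 (iInf_le_of_le h1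
    (iInf_le_of_le (fun t _ => W.mem_leaf_of_samePlaqueIn ⟨x, γ₀ t, y, rfl, rfl⟩) le_rfl))))

end LeafDisk

end Foliation

/-! ### Fubini's theorem with holonomy -/

section Fubini

variable {X Y : Type*} [NormedAddCommGroup X] [NormedSpace ℝ X] [FiniteDimensional ℝ X]
  [MeasureSpace X] [BorelSpace X] [(volume : Measure X).IsAddHaarMeasure]
  [NormedAddCommGroup Y] [NormedSpace ℝ Y] [FiniteDimensional ℝ Y]
  [MeasureSpace Y] [BorelSpace Y] [(volume : Measure Y).IsAddHaarMeasure]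

/-- Fubini's theorem along a continuous family of graphs with absolutely continuous holonomy: a set
which meets every graph in a null set is a null set. -/
lemma measure_image_eq_zero_of_holonomy {Φ : X × Y → X × Y} {ε δ : ℝ} {κ : Y → Y}
    (hΦc : ContinuousOn Φ (Metric.ball 0 ε ×ˢ Metric.ball 0 ε))
    (hΦi : InjOn Φ (Metric.ball 0 ε ×ˢ Metric.ball 0 ε))
    (hPd : ∀ y ∈ Metric.ball (0 : Y) ε,
      DifferentiableOn ℝ (fun x => (Φ (x, y)).1) (Metric.ball 0 ε))
    (hPi : ∀ y ∈ Metric.ball (0 : Y) ε, InjOn (fun x => (Φ (x, y)).1) (Metric.ball 0 ε))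
    (hκ : ContinuousOn κ (Metric.ball 0 δ))
    (hκm : MapsTo κ (Metric.ball 0 δ) (Metric.ball 0 ε))
    (hol : ∀ u ∈ Metric.ball (0 : X) δ, ∀ N ⊆ Metric.ball (0 : Y) δ, volume N = 0 →
      volume {t ∈ Metric.ball (0 : Y) δ | ∃ s ∈ N, ∃ x ∈ Metric.ball (0 : X) ε,
        Φ (x, κ s) = (u, t)} = 0)
    {A : Set (X × Y)} (hA : MeasurableSet A) (hAε : A ⊆ Metric.ball 0 ε ×ˢ Metric.ball 0 ε)
    (hAδ : MapsTo Φ A (Metric.ball 0 δ ×ˢ Metric.ball 0 δ))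
    (hAκ : ∀ z ∈ A, ∃ s ∈ Metric.ball (0 : Y) δ, κ s = z.2)
    (hA0 : ∀ y ∈ Metric.ball (0 : Y) ε, volume {x | (x, y) ∈ A} = 0) :
    volume (Φ '' A) = 0 := by
  set O : Set (X × Y) := Metric.ball 0 ε ×ˢ Metric.ball 0 δ with hO
  have hOm : MeasurableSet O := measurableSet_ball.prod measurableSet_ball
  set h : X × Y → X × Y := fun z => (z.1, κ z.2) with hh
  have hhc : ContinuousOn h O :=
    continuousOn_fst.prodMk (hκ.comp continuousOn_snd fun z hz => hz.2)
  have hhm : MapsTo h O (Metric.ball 0 ε ×ˢ Metric.ball 0 ε) := fun z hz => ⟨hz.1, hκm hz.2⟩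
  set G : Set (X × Y) := O ∩ h ⁻¹' A with hG
  have hGm : MeasurableSet G := by
    have h1 := hOm.subtype_image (hhc.domRestrict.measurable hA)
    convert h1 using 1
    ext z
    simp [hG, and_comm]
  -- Graphs are labelled by the point `s` where they cross the central vertical disk. The map `Θ`
  -- straightens each graph to the horizontal line at height `s`, without moving the first
  -- coordinate.
  set Θ : X × Y → X × Y := fun z => ((Φ (z.1, κ z.2)).1, z.2) with hΘ
  have hΘc : ContinuousOn Θ G := by
    have h1 : ContinuousOn (fun z => Φ (h z)) O := hΦc.comp hhc hhm
    exact (h1.fst.prodMk continuousOn_snd).mono inter_subset_left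
  have hΘi : InjOn Θ G := by
    rintro ⟨x, s⟩ hz ⟨x', s'⟩ hz' he
    simp only [hΘ, Prod.mk.injEq] at he
    obtain ⟨he1, rfl⟩ := he
    exact Prod.ext (hPi (κ s) (hκm hz.1.2) hz.1.1 hz'.1.1 he1) rfl
  have hBm : MeasurableSet (Θ '' G) := hGm.image_of_continuousOn_injOn hΘc hΘi
  -- Each horizontal slice is the image of a null set under a differentiable map between spaces of
  -- equal dimension.
  have hB0 : (volume : Measure (X × Y)) (Θ '' G) = 0 := by
    rw [Measure.volume_eq_prod, Measure.prod_apply_symm hBm]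
    refine (lintegral_congr fun s => ?_).trans lintegral_zero
    by_cases hs : s ∈ Metric.ball (0 : Y) δ
    · have hsub : (fun x => (x, s)) ⁻¹' (Θ '' G) ⊆
          (fun x => (Φ (x, κ s)).1) '' {x | (x, κ s) ∈ A} := by
        rintro u ⟨⟨x, s'⟩, hz, he⟩
        simp only [hΘ, Prod.mk.injEq] at he
        obtain ⟨rfl, rfl⟩ := he
        exact ⟨x, hz.2, rfl⟩
      refine measure_mono_null hsub ?_
      refine addHaar_image_eq_zero_of_differentiableOn_of_addHaar_eq_zero volume ?_
        (hA0 _ (hκm hs))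
      exact (hPd _ (hκm hs)).mono fun x hx => (hAε hx).1
    · convert measure_empty (μ := (volume : Measure X))
      refine eq_empty_of_forall_notMem ?_
      rintro u ⟨⟨x, s'⟩, hz, he⟩
      simp only [hΘ, Prod.mk.injEq] at he
      exact hs (he.2 ▸ hz.1.2)
  have hae : ∀ᵐ u : X, volume (Prod.mk u ⁻¹' (Θ '' G)) = 0 := by
    rw [Measure.volume_eq_prod] at hB0
    exact Measure.measure_ae_null_of_prod_null hB0
  have himm : MeasurableSet (Φ '' A) :=
    hA.image_of_continuousOn_injOn (hΦc.mono hAε) (hΦi.mono hAε)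
  rw [Measure.volume_eq_prod, Measure.measure_prod_null himm]
  filter_upwards [hae] with u hu
  by_cases huδ : u ∈ Metric.ball (0 : X) δ
  · have hN : Prod.mk u ⁻¹' (Θ '' G) ⊆ Metric.ball (0 : Y) δ := by
      rintro s ⟨⟨x, s'⟩, hz, he⟩
      simp only [hΘ, Prod.mk.injEq] at he
      exact he.2 ▸ hz.1.2
    -- The holonomy from the central disk to the disk over `u` carries the null vertical slice of `Θ
    -- '' G` onto a set containing the slice of `Φ '' A`.
    refine measure_mono_null ?_ (hol u huδ _ hN hu)
    rintro t ⟨⟨x, y⟩, hz, he⟩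
    obtain ⟨s, hs, hsy⟩ := hAκ _ hz
    simp only at hsy
    subst hsy
    refine ⟨?_, s, ⟨(x, s), ⟨⟨(hAε hz).1, hs⟩, hz⟩, ?_⟩, x, (hAε hz).1, he⟩
    · have h1 := hAδ hz
      rw [he] at h1
      exact h1.2
    · simp only [hΘ, he]
  · refine (congrArg volume ?_).trans (measure_empty (μ := (volume : Measure Y)))
    refine eq_empty_of_forall_notMem ?_
    rintro t ⟨z, hz, he⟩
    have h1 := hAδ hz
    rw [he] at h1
    exact huδ h1.1

end Fubini

/-! ### Null sets in charts, linear algebra and perturbations of the identity -/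

/-- A measure with smooth positive densities gives measure zero to the sets which are null in a
chart. -/
lemma IsSmoothVolume.measure_eq_zero {n : ℕ} {M : Type*} [TopologicalSpace M]
    [ChartedSpace (EuclideanSpace ℝ (Fin n)) M] [MeasurableSpace M] {μ : Measure M}
    (hμ : IsSmoothVolume n μ) {c : OpenPartialHomeomorph M (EuclideanSpace ℝ (Fin n))}
    (hc : c ∈ atlas (EuclideanSpace ℝ (Fin n)) M) {A : Set M} (hA : A ⊆ c.source)
    (hAm : MeasurableSet A) (h : volume (c '' A) = 0) : μ A = 0 := by
  obtain ⟨ρ, -, -, hρ⟩ := hμ c hc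
  rw [hρ A hA hAm, Measure.restrict_eq_zero.2 h, lintegral_zero_measure]

/-- A linear isomorphism straightening the image of an injective linear map. -/
lemma exists_equiv_straightening {n k : ℕ}
    {B : EuclideanSpace ℝ (Fin k) →ₗ[ℝ] EuclideanSpace ℝ (Fin n)} (hB : Function.Injective B) :
    ∃ L : EuclideanSpace ℝ (Fin n) ≃L[ℝ]
      EuclideanSpace ℝ (Fin k) × EuclideanSpace ℝ (Fin (n - k)), ∀ w, L (B w) = (w, 0) := by
  obtain ⟨Q, hQ⟩ := Submodule.exists_isCompl (LinearMap.range B)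
  have hdim : Module.finrank ℝ Q = n - k := by
    have h1 := Submodule.finrank_add_eq_of_isCompl hQ
    rw [LinearMap.finrank_range_of_inj hB, finrank_euclideanSpace_fin,
      finrank_euclideanSpace_fin] at h1
    omega
  let e : Q ≃ₗ[ℝ] EuclideanSpace ℝ (Fin (n - k)) :=
    LinearEquiv.ofFinrankEq _ _ (by rw [hdim, finrank_euclideanSpace_fin])
  let L := ((Submodule.prodEquivOfIsCompl _ _ hQ).symm.trans
    ((LinearEquiv.ofInjective B hB).symm.prodCongr e))
  refine ⟨L.toContinuousLinearEquiv, fun w => ?_⟩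
  change L (B w) = _
  have h1 : (Submodule.prodEquivOfIsCompl _ _ hQ).symm (B w) =
      (LinearEquiv.ofInjective B hB w, 0) := by
    rw [LinearEquiv.symm_apply_eq]
    simp
  simp [L, h1]

lemma addHaar_preimage_equiv_sub_eq_zero {X Z : Type*} [NormedAddCommGroup X] [NormedSpace ℝ X]
    [FiniteDimensional ℝ X] [MeasureSpace X] [BorelSpace X] [(volume : Measure X).IsAddHaarMeasure]
    [NormedAddCommGroup Z] [NormedSpace ℝ Z] [FiniteDimensional ℝ Z]
    [MeasureSpace Z] [BorelSpace Z] [(volume : Measure Z).IsAddHaarMeasure]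
    (L : X ≃L[ℝ] Z) (b : X) {S : Set Z} (hS : volume S = 0) :
    volume ((fun x => L (x - b)) ⁻¹' S) = 0 := by
  have h1 : (Measure.map L (volume : Measure X)).IsAddHaarMeasure := L.isAddHaarMeasure_map volume
  have h2 : Measure.map L (volume : Measure X) ≪ volume :=
    Measure.absolutelyContinuous_isAddHaarMeasure _ _
  have h3 : volume (L ⁻¹' S) = 0 :=
    Measure.QuasiMeasurePreserving.preimage_null ⟨L.continuous.measurable, h2⟩ hS
  exact (measurePreserving_sub_right volume b).quasiMeasurePreserving.preimage_null h3

section Linear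

/-- Under `D` the range of `T` is vertical while that of `S` contains no nonzero vertical vector;
dimensions do the rest. -/
lemma isCompl_range_of_comp_eq {X Y Z : Type*} [AddCommGroup X] [Module ℝ X]
    [FiniteDimensional ℝ X] [AddCommGroup Y] [Module ℝ Y] [FiniteDimensional ℝ Y]
    [AddCommGroup Z] [Module ℝ Z] [FiniteDimensional ℝ Z] (D : Z →ₗ[ℝ] X × Y) (T : Y →ₗ[ℝ] Z)
    (S : X →ₗ[ℝ] Z) {δ : ℝ} (hδ : δ ≠ 0) (hT : ∀ b, D (T b) = (0, δ • b))
    (hS : ∀ a, (D (S a)).1 = 0 → a = 0)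
    (hdim : Module.finrank ℝ Z ≤ Module.finrank ℝ X + Module.finrank ℝ Y) :
    IsCompl (LinearMap.range T) (LinearMap.range S) := by
  have hTi : Function.Injective T := by
    refine (injective_iff_map_eq_zero T).2 fun b hb => ?_
    have h1 := hT b
    rw [hb, map_zero] at h1
    exact (smul_eq_zero.1 (congrArg Prod.snd h1).symm).resolve_left hδ
  have hSi : Function.Injective S := by
    refine (injective_iff_map_eq_zero S).2 fun a ha => hS a ?_
    rw [ha, map_zero, Prod.fst_zero]
  refine (Submodule.isCompl_iff_disjoint _ _ ?_).2 ?_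
  · rw [LinearMap.finrank_range_of_inj hTi, LinearMap.finrank_range_of_inj hSi]
    omega
  · rw [Submodule.disjoint_def]
    rintro _ ⟨b, rfl⟩ ⟨a, ha⟩
    have h1 : a = 0 := hS a (by rw [ha, hT])
    rw [← ha, h1, map_zero]

variable {X Y : Type*} [NormedAddCommGroup X] [NormedSpace ℝ X] [NormedAddCommGroup Y]

/-- A family of maps whose derivative depends continuously on the parameter and is the identity at
the origin is uniformly approximated by the identity. -/
lemma exists_ball_approximatesLinearOn_id {P : X × Y → X} {P' : X × Y → X →L[ℝ] X}
    {O : Set (X × Y)} (hO : IsOpen O) (h0 : (0, 0) ∈ O) (hP' : ContinuousOn P' O)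
    (hP : ∀ z ∈ O, HasFDerivAt (fun x => P (x, z.2)) (P' z) z.1)
    (hid : P' (0, 0) = ContinuousLinearMap.id ℝ X) :
    ∃ ε > 0, Metric.ball (0 : X) ε ×ˢ Metric.ball (0 : Y) ε ⊆ O ∧
      (∀ z ∈ Metric.ball (0 : X) ε ×ˢ Metric.ball (0 : Y) ε, ∀ a, P' z a = 0 → a = 0) ∧
      ∀ y ∈ Metric.ball (0 : Y) ε, ApproximatesLinearOn (fun x => P (x, y))
        (ContinuousLinearMap.id ℝ X) (Metric.ball 0 ε) (1 / 2) := by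
  have hev : ∀ᶠ z in 𝓝 ((0 : X), (0 : Y)), z ∈ O ∧
      ‖P' z - ContinuousLinearMap.id ℝ X‖ < 1 / 2 := by
    refine (hO.eventually_mem h0).and ?_
    have h1 : ContinuousAt (fun z => ‖P' z - ContinuousLinearMap.id ℝ X‖) ((0 : X), (0 : Y)) :=
      ((hP'.continuousAt (hO.mem_nhds h0)).sub continuousAt_const).norm
    exact h1.eventually_lt continuousAt_const (by simp [hid])
  obtain ⟨ε, hε, hball⟩ := Metric.mem_nhds_iff.1 hev
  rw [← ball_prod_same] at hball
  refine ⟨ε, hε, fun z hz => (hball hz).1, fun z hz a ha => ?_, fun y hy => ?_⟩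
  · have h1 := (P' z - ContinuousLinearMap.id ℝ X).le_of_opNorm_le (hball hz).2.le a
    simp only [sub_apply, ha, ContinuousLinearMap.id_apply, zero_sub,
      norm_neg] at h1
    exact norm_eq_zero.1 (le_antisymm (by linarith) (norm_nonneg a))
  · intro x hx x' hx'
    refine (convex_ball (0 : X) ε).norm_image_sub_le_of_norm_hasFDerivWithin_le'
      (f := fun x => P (x, y)) (f' := fun x => P' (x, y))
      (fun x hx => (hP (x, y) (hball ⟨hx, hy⟩).1).hasFDerivWithinAt)
      (fun x hx => ?_) hx' hx
    simpa using (hball (show (x, y) ∈ _ from ⟨hx, hy⟩)).2.le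

/-- The radius is `(1 - 1/2) * r`, from the quantitative inverse function theorem. This is what
forces nearby plaques to cross the central vertical disk. -/
lemma ApproximatesLinearOn.surjOn_closedBall_id [CompleteSpace X] {f : X → X} {ε r : ℝ}
    (hf : ApproximatesLinearOn f (ContinuousLinearMap.id ℝ X) (Metric.ball 0 ε) (1 / 2))
    (hr0 : 0 ≤ r) (hr : r < ε) :
    SurjOn f (Metric.closedBall 0 r) (Metric.closedBall (f 0) (r / 2)) := by
  let R : (ContinuousLinearMap.id ℝ X).NonlinearRightInverse :=
    { toFun := id
      nnnorm := 1
      bound' := fun y => by simp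
      right_inv' := fun y => rfl }
  have h1 := hf.surjOn_closedBall_of_nonlinearRightInverse R hr0
    (Metric.closedBall_subset_ball hr)
  have h2 : (((R.nnnorm : ℝ)⁻¹ - ((1 / 2 : NNReal) : ℝ)) * r) = r / 2 := by
    simp only [R]
    norm_num
    ring
  rwa [h2] at h1

lemma ApproximatesLinearOn.injOn_id {f : X → X} {s : Set X}
    (hf : ApproximatesLinearOn f (ContinuousLinearMap.id ℝ X) s (1 / 2)) : InjOn f s := by
  intro x hx x' hx' h
  have h1 := hf x hx x' hx'
  simp only [h, sub_self, ContinuousLinearMap.id_apply, zero_sub, norm_neg] at h1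
  have h2 : ‖x - x'‖ ≤ 1 / 2 * ‖x - x'‖ := by simpa using h1
  exact sub_eq_zero.1 (norm_eq_zero.1 (le_antisymm (by linarith) (norm_nonneg _)))

end Linear

section ChartCoord

variable {n k : ℕ} {M : Type*} [TopologicalSpace M]
  [ChartedSpace (EuclideanSpace ℝ (Fin n)) M]
  {Z : Type*} [NormedAddCommGroup Z] [NormedSpace ℝ Z]

/-- The chart at `p`, centered at `p` and composed with a linear isomorphism. -/
noncomputable def chartCoord (p : M) (L : EuclideanSpace ℝ (Fin n) ≃L[ℝ] Z) (q : M) : Z :=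
  L (extChartAt (𝓡 n) p q - extChartAt (𝓡 n) p p)

/-- The inverse of `chartCoord`. -/
noncomputable def chartCoordInv (p : M) (L : EuclideanSpace ℝ (Fin n) ≃L[ℝ] Z) (z : Z) : M :=
  (extChartAt (𝓡 n) p).symm (extChartAt (𝓡 n) p p + L.symm z)

/-- The domain of `chartCoordInv`. -/
def chartCoordTarget (p : M) (L : EuclideanSpace ℝ (Fin n) ≃L[ℝ] Z) : Set Z :=
  {z | extChartAt (𝓡 n) p p + L.symm z ∈ (extChartAt (𝓡 n) p).target}

variable {p : M} {L : EuclideanSpace ℝ (Fin n) ≃L[ℝ] Z}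

lemma chartCoord_self : chartCoord p L p = 0 := by simp [chartCoord]

lemma chartCoordInv_zero : chartCoordInv p L 0 = p := by
  simp [chartCoordInv]

lemma zero_mem_chartCoordTarget : 0 ∈ chartCoordTarget p L := by
  simp only [chartCoordTarget, mem_ofPred_eq, map_zero, add_zero]
  exact mem_extChartAt_target p

lemma isOpen_chartCoordTarget : IsOpen (chartCoordTarget p L) :=
  (isOpen_extChartAt_target (I := 𝓡 n) p).preimage (by fun_prop)

lemma chartCoord_chartCoordInv {z : Z} (hz : z ∈ chartCoordTarget p L) :
    chartCoord p L (chartCoordInv p L z) = z := by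
  rw [chartCoord, chartCoordInv, (extChartAt (𝓡 n) p).right_inv hz]
  simp

lemma chartCoordInv_chartCoord {q : M} (hq : q ∈ (extChartAt (𝓡 n) p).source) :
    chartCoordInv p L (chartCoord p L q) = q := by
  rw [chartCoord, chartCoordInv, L.symm_apply_apply, add_sub_cancel,
    (extChartAt (𝓡 n) p).left_inv hq]

lemma chartCoordInv_mem_source {z : Z} (hz : z ∈ chartCoordTarget p L) :
    chartCoordInv p L z ∈ (extChartAt (𝓡 n) p).source :=
  (extChartAt (𝓡 n) p).map_target hz

lemma continuousOn_chartCoord : ContinuousOn (chartCoord p L) (extChartAt (𝓡 n) p).source :=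
  L.continuous.comp_continuousOn ((continuousOn_extChartAt p).sub continuousOn_const)

lemma continuousOn_chartCoordInv : ContinuousOn (chartCoordInv p L) (chartCoordTarget p L) :=
  (continuousOn_extChartAt_symm p).comp (by fun_prop) fun _ hz => hz

variable [IsManifold (𝓡 n) ∞ M]

lemma contMDiffOn_chartCoordInv :
    ContMDiffOn 𝓘(ℝ, Z) (𝓡 n) ∞ (chartCoordInv p L) (chartCoordTarget p L) := by
  refine (contMDiffOn_extChartAt_symm p).comp ?_ fun _ hz => hz
  have h1 : ContDiff ℝ ∞ fun z => extChartAt (𝓡 n) p p + L.symm z := by fun_prop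
  exact h1.contMDiff.contMDiffOn

end ChartCoord

/-! ### Plaques in a chart and vertical transverse disks -/

namespace Foliation

variable {n k : ℕ} {M : Type*} [TopologicalSpace M]
  [ChartedSpace (EuclideanSpace ℝ (Fin n)) M] [IsManifold (𝓡 n) ∞ M] (W : Foliation n k M)

section

variable {p : M}

lemma differentiableAt_extChartAt_box {z : EuclideanSpace ℝ (Fin k) × EuclideanSpace ℝ (Fin (n - k))}
    (hz : W.box p z ∈ (extChartAt (𝓡 n) p).source) :
    DifferentiableAt ℝ (fun x => extChartAt (𝓡 n) p (W.box p (x, z.2))) z.1 := by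
  rw [extChartAt_source] at hz
  have h1 : MDifferentiableAt (𝓡 n) 𝓘(ℝ, EuclideanSpace ℝ (Fin n)) (extChartAt (𝓡 n) p)
      (W.box p (z.1, z.2)) := mdifferentiableAt_extChartAt hz
  exact (h1.comp z.1 (((W.contMDiff_plaque p z.2).mdifferentiable one_ne_zero)
    z.1)).differentiableAt

lemma fderiv_extChartAt_box {z : EuclideanSpace ℝ (Fin k) × EuclideanSpace ℝ (Fin (n - k))}
    (hz : W.box p z ∈ (extChartAt (𝓡 n) p).source) (w : EuclideanSpace ℝ (Fin k)) :
    fderiv ℝ (fun x => extChartAt (𝓡 n) p (W.box p (x, z.2))) z.1 w =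
      mfderiv (𝓡 n) 𝓘(ℝ, EuclideanSpace ℝ (Fin n)) (extChartAt (𝓡 n) p) (W.box p (z.1, z.2))
        (mfderiv (𝓡 k) (𝓡 n) (fun x => W.box p (x, z.2)) z.1 w) := by
  rw [extChartAt_source] at hz
  have h1 : MDifferentiableAt (𝓡 n) 𝓘(ℝ, EuclideanSpace ℝ (Fin n)) (extChartAt (𝓡 n) p)
      (W.box p (z.1, z.2)) := mdifferentiableAt_extChartAt hz
  rw [← mfderiv_eq_fderiv]
  have h2 := mfderiv_comp z.1 h1 (((W.contMDiff_plaque p z.2).mdifferentiable one_ne_zero) z.1)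
  exact congrArg (fun A : EuclideanSpace ℝ (Fin k) →L[ℝ] EuclideanSpace ℝ (Fin n) => A w) h2

/-- The fibre part of the trivialization at `p` is the derivative of the chart, so continuity into
the tangent bundle becomes continuity of each directional derivative. -/
lemma continuousOn_fderiv_extChartAt_box :
    ContinuousOn (fun z : EuclideanSpace ℝ (Fin k) × EuclideanSpace ℝ (Fin (n - k)) =>
      fderiv ℝ (fun x => extChartAt (𝓡 n) p (W.box p (x, z.2))) z.1)
      (W.box p ⁻¹' (extChartAt (𝓡 n) p).source) := by
  rw [continuousOn_clm_apply]
  intro w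
  have h1 := W.continuous_mfderiv_plaque p w
  have h2 : ContinuousOn
      (fun z : EuclideanSpace ℝ (Fin k) × EuclideanSpace ℝ (Fin (n - k)) =>
        ((trivializationAt (EuclideanSpace ℝ (Fin n)) (TangentSpace (𝓡 n)) p)
          (⟨W.box p (z.1, z.2), mfderiv (𝓡 k) (𝓡 n) (fun u => W.box p (u, z.2)) z.1 w⟩ :
            TangentBundle (𝓡 n) M)).2)
      (W.box p ⁻¹' (extChartAt (𝓡 n) p).source) := by
    refine continuous_snd.comp_continuousOn
      ((trivializationAt (EuclideanSpace ℝ (Fin n)) (TangentSpace (𝓡 n)) p).continuousOn.comp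
        h1.continuousOn fun z hz => ?_)
    rw [Trivialization.mem_source, TangentBundle.trivializationAt_baseSet]
    rw [mem_preimage, extChartAt_source] at hz
    exact hz
  refine h2.congr fun z hz => ?_
  have hz' : W.box p (z.1, z.2) ∈ (chartAt (EuclideanSpace ℝ (Fin n)) p).source := by
    rw [mem_preimage, extChartAt_source] at hz
    exact hz
  have h3 := TangentBundle.continuousLinearMapAt_trivializationAt (I := 𝓡 n) hz'
  refine (W.fderiv_extChartAt_box hz w).trans ?_
  have hb : W.box p (z.1, z.2) ∈ (trivializationAt (EuclideanSpace ℝ (Fin n))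
      (TangentSpace (𝓡 n)) p).baseSet := by
    rw [TangentBundle.trivializationAt_baseSet]
    exact hz'
  have h4 := (trivializationAt (EuclideanSpace ℝ (Fin n)) (TangentSpace (𝓡 n))
    p).continuousLinearMapAt_apply_of_mem (R := ℝ) hb
      (mfderiv (𝓡 k) (𝓡 n) (fun x => W.box p (x, z.2)) z.1 w)
  rw [h3] at h4
  exact h4

end

end Foliation

namespace Foliation

variable {n k : ℕ} {M : Type*} [TopologicalSpace M]
  [ChartedSpace (EuclideanSpace ℝ (Fin n)) M] [IsManifold (𝓡 n) ∞ M] (W : Foliation n k M)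

lemma tangent_eq_range_of_eq_box [CompactSpace M] {p q : M}
    {z : EuclideanSpace ℝ (Fin k) × EuclideanSpace ℝ (Fin (n - k))} (h : W.box p z = q) :
    (W.tangent q : Submodule ℝ (EuclideanSpace ℝ (Fin n))) =
      LinearMap.range (W.plaqueDeriv p z.1 z.2 :
        EuclideanSpace ℝ (Fin k) →ₗ[ℝ] EuclideanSpace ℝ (Fin n)) := by
  subst h
  exact W.tangent_box p z.1 z.2

variable [CompactSpace M] {p : M}
  {L : EuclideanSpace ℝ (Fin n) ≃L[ℝ] EuclideanSpace ℝ (Fin k) × EuclideanSpace ℝ (Fin (n - k))}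
  {ε δ : ℝ}

/-- The vertical disks in a chart are transverse to the foliation if the foliation is nearly
horizontal in this chart. -/
lemma isTransverseDisk_chartCoordInv (hδ : 0 < δ)
    (hinj : ∀ y ∈ Metric.ball (0 : EuclideanSpace ℝ (Fin (n - k))) ε,
      InjOn (fun x : EuclideanSpace ℝ (Fin k) => (chartCoord p L (W.box p (x, y))).1)
        (Metric.ball 0 ε))
    (hder : ∀ z ∈ Metric.ball (0 : EuclideanSpace ℝ (Fin k)) ε ×ˢ
      Metric.ball (0 : EuclideanSpace ℝ (Fin (n - k))) ε, ∀ a,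
      (L (fderiv ℝ (fun x => extChartAt (𝓡 n) p (W.box p (x, z.2))) z.1 a)).1 = 0 → a = 0)
    (hT : ∀ z ∈ Metric.ball (0 : EuclideanSpace ℝ (Fin k)) δ ×ˢ
      Metric.ball (0 : EuclideanSpace ℝ (Fin (n - k))) δ, z ∈ chartCoordTarget p L ∧
      chartCoordInv p L z ∈ W.box p '' (Metric.ball 0 ε ×ˢ Metric.ball 0 ε))
    {u : EuclideanSpace ℝ (Fin k)} (hu : u ∈ Metric.ball 0 δ) :
    W.IsTransverseDisk p (fun t => chartCoordInv p L (u, δ • t)) := by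
  have hmem : ∀ t ∈ Metric.ball (0 : EuclideanSpace ℝ (Fin (n - k))) 1,
      (u, δ • t) ∈ Metric.ball (0 : EuclideanSpace ℝ (Fin k)) δ ×ˢ
        Metric.ball (0 : EuclideanSpace ℝ (Fin (n - k))) δ := by
    intro t ht
    refine ⟨hu, ?_⟩
    rw [mem_ball_zero_iff] at ht
    rw [mem_ball_zero_iff, norm_smul, Real.norm_eq_abs, abs_of_pos hδ]
    exact mul_lt_of_lt_one_right hδ ht
  have hsm : ContMDiffOn (𝓡 (n - k)) (𝓡 n) ∞ (fun t => chartCoordInv p L (u, δ • t))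
      (Metric.ball 0 1) := by
    refine contMDiffOn_chartCoordInv.comp ?_ fun t ht => (hT _ (hmem t ht)).1
    have h1 : ContDiff ℝ ∞ fun t : EuclideanSpace ℝ (Fin (n - k)) => (u, δ • t) := by fun_prop
    exact h1.contMDiff.contMDiffOn
  refine ⟨hsm, fun t ht => image_subset_range _ _ (hT _ (hmem t ht)).2, fun t ht => ?_, ?_⟩
  · obtain ⟨z, hz, hzq⟩ := (hT _ (hmem t ht)).2
    set τ : EuclideanSpace ℝ (Fin (n - k)) → M := fun t => chartCoordInv p L (u, δ • t) with hτ
    have hsrc : τ t ∈ (extChartAt (𝓡 n) p).source := chartCoordInv_mem_source (hT _ (hmem t ht)).1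
    have hsrc' : W.box p z ∈ (extChartAt (𝓡 n) p).source := hzq ▸ hsrc
    have hsrc2 : τ t ∈ (chartAt (EuclideanSpace ℝ (Fin n)) p).source := by
      rwa [extChartAt_source] at hsrc
    have hchart : MDifferentiableAt (𝓡 n) 𝓘(ℝ, EuclideanSpace ℝ (Fin n)) (extChartAt (𝓡 n) p)
      (τ t) := mdifferentiableAt_extChartAt hsrc2
    have hτd : MDifferentiableAt (𝓡 (n - k)) (𝓡 n) τ t :=
      ((hsm t ht).contMDiffAt (Metric.isOpen_ball.mem_nhds ht)).mdifferentiableAt (by simp)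
    let D : EuclideanSpace ℝ (Fin n) →L[ℝ] EuclideanSpace ℝ (Fin n) :=
      mfderiv (𝓡 n) 𝓘(ℝ, EuclideanSpace ℝ (Fin n)) (extChartAt (𝓡 n) p) (τ t)
    let T : EuclideanSpace ℝ (Fin (n - k)) →L[ℝ] EuclideanSpace ℝ (Fin n) :=
      mfderiv (𝓡 (n - k)) (𝓡 n) τ t
    have hcomp : fderiv ℝ (fun t => extChartAt (𝓡 n) p (τ t)) t = D.comp T := by
      rw [← mfderiv_eq_fderiv]
      exact mfderiv_comp t hchart hτd
    have hT' : ∀ b, L (D (T b)) = (0, δ • b) := by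
      intro b
      have h1 : HasFDerivAt (fun t => extChartAt (𝓡 n) p (τ t)) (D.comp T) t := by
        rw [← hcomp]
        exact (hchart.comp t hτd).differentiableAt.hasFDerivAt
      have h2 : HasFDerivAt (fun t => chartCoord p L (τ t))
          ((L : EuclideanSpace ℝ (Fin n) →L[ℝ] _).comp (D.comp T)) t :=
        (L.hasFDerivAt).comp t (h1.sub_const _)
      have h3 : HasFDerivAt (fun t : EuclideanSpace ℝ (Fin (n - k)) => (u, δ • t))
          ((0 : EuclideanSpace ℝ (Fin (n - k)) →L[ℝ] EuclideanSpace ℝ (Fin k)).prod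
            (δ • ContinuousLinearMap.id ℝ _)) t :=
        (hasFDerivAt_const u t).prodMk ((hasFDerivAt_id t).const_smul δ)
      have h4 : (fun t => chartCoord p L (τ t)) =ᶠ[𝓝 t] fun t => (u, δ • t) := by
        filter_upwards [Metric.isOpen_ball.mem_nhds ht] with t' ht'
        exact chartCoord_chartCoordInv (hT _ (hmem t' ht')).1
      have h5 := (h2.congr_of_eventuallyEq h4.symm).unique h3
      exact congrArg (fun A : EuclideanSpace ℝ (Fin (n - k)) →L[ℝ]
        EuclideanSpace ℝ (Fin k) × EuclideanSpace ℝ (Fin (n - k)) => A b) h5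
    have hS : ∀ a, (L (D ((W.plaqueDeriv p z.1 z.2 :
        EuclideanSpace ℝ (Fin k) →ₗ[ℝ] EuclideanSpace ℝ (Fin n)) a))).1 = 0 → a = 0 := by
      intro a ha
      refine hder z hz a ?_
      have h1 := W.fderiv_extChartAt_box hsrc' a
      have key : ∀ q, W.box p z = q → ∀ v : EuclideanSpace ℝ (Fin n),
          (mfderiv (𝓡 n) 𝓘(ℝ, EuclideanSpace ℝ (Fin n)) (extChartAt (𝓡 n) p) (W.box p z) :
            EuclideanSpace ℝ (Fin n) →L[ℝ] EuclideanSpace ℝ (Fin n)) v =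
          (mfderiv (𝓡 n) 𝓘(ℝ, EuclideanSpace ℝ (Fin n)) (extChartAt (𝓡 n) p) q :
            EuclideanSpace ℝ (Fin n) →L[ℝ] EuclideanSpace ℝ (Fin n)) v := by
        rintro q rfl v
        rfl
      have h2 := key _ hzq ((W.plaqueDeriv p z.1 z.2 :
        EuclideanSpace ℝ (Fin k) →ₗ[ℝ] EuclideanSpace ℝ (Fin n)) a)
      have h3 : fderiv ℝ (fun x => extChartAt (𝓡 n) p (W.box p (x, z.2))) z.1 a =
          D ((W.plaqueDeriv p z.1 z.2 :
            EuclideanSpace ℝ (Fin k) →ₗ[ℝ] EuclideanSpace ℝ (Fin n)) a) := h1.trans h2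
      rw [h3]
      exact ha
    have hc := isCompl_range_of_comp_eq
      (L.toLinearEquiv.toLinearMap ∘ₗ D.toLinearMap) T.toLinearMap
      (W.plaqueDeriv p z.1 z.2 : EuclideanSpace ℝ (Fin k) →ₗ[ℝ] EuclideanSpace ℝ (Fin n))
      hδ.ne' hT' hS (by simp only [finrank_euclideanSpace_fin]; omega)
    have key : ∀ A B C : Submodule ℝ (EuclideanSpace ℝ (Fin n)), IsCompl A B → C = B →
        IsCompl A C := by
      rintro A B _ h rfl
      exact h
    exact key _ _ _ hc (W.tangent_eq_range_of_eq_box hzq)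
  -- Both points have first coordinate `u`, and the first coordinate is injective on a plaque, so
  -- the points coincide.
  · intro s hs t ht hst
    obtain ⟨x, x', y, h1, h2⟩ := hst
    obtain ⟨z, hz, hzq⟩ := (hT _ (hmem s hs)).2
    obtain ⟨z', hz', hzq'⟩ := (hT _ (hmem t ht)).2
    have e1 : z = (x, y) := W.injective_box p (hzq.trans h1.symm)
    have e2 : z' = (x', y) := W.injective_box p (hzq'.trans h2.symm)
    subst e1 e2
    have c1 := chartCoord_chartCoordInv (hT _ (hmem s hs)).1
    have c2 := chartCoord_chartCoordInv (hT _ (hmem t ht)).1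
    rw [← hzq] at c1
    rw [← hzq'] at c2
    have e3 : x = x' := hinj y hz.2 hz.1 hz'.1 (by simp only [c1, c2])
    subst e3
    rw [c1] at c2
    exact smul_right_injective _ hδ.ne' (congrArg Prod.snd c2)

end Foliation

/-! ### Absolute continuity: sets null in every plaque are null -/

namespace Foliation

variable {n k : ℕ} {M : Type*} [TopologicalSpace M] [CompactSpace M]
  [ChartedSpace (EuclideanSpace ℝ (Fin n)) M] [IsManifold (𝓡 n) ∞ M] {W : Foliation n k M}
  [MeasurableSpace M] [BorelSpace M]

set_option maxHeartbeats 400000 in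
/-- Absolute continuity implies that, near every point, a set which meets every plaque in a null set
is a null set. -/
lemma IsAbsolutelyContinuous.exists_nhds_measure_eq_zero (hac : W.IsAbsolutelyContinuous)
    {μ : Measure M} (hμ : IsSmoothVolume n μ) (p : M) :
    ∃ V ∈ 𝓝 p, ∀ A ⊆ V, MeasurableSet A → (∀ y, volume {x | W.box p (x, y) ∈ A} = 0) →
      μ A = 0 := by
  have h00 : W.box p (0, 0) = p := W.box_zero p
  set ec := extChartAt (𝓡 n) p with hec
  set O := W.box p ⁻¹' ec.source with hO
  have hOo : IsOpen O := (isOpen_extChartAt_source p).preimage (W.continuous_box p)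
  have hO0 : (0, 0) ∈ O := by
    rw [hO, mem_preimage, h00]
    exact mem_extChartAt_source p
  have hD0 : Function.Injective (fderiv ℝ (fun x => ec (W.box p (x, 0))) 0) := by
    have h1 : Function.Injective (mfderiv (𝓡 n) 𝓘(ℝ, EuclideanSpace ℝ (Fin n)) ec
        (W.box p (0, 0))) := (isInvertible_mfderiv_extChartAt hO0).injective
    intro a b hab
    have h2 := W.fderiv_extChartAt_box (z := (0, 0)) hO0 a
    have h3 := W.fderiv_extChartAt_box (z := (0, 0)) hO0 b
    exact W.injective_mfderiv_plaque p 0 0 (h1 (h2.symm.trans (hab.trans h3)))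
  -- The isomorphism makes the plaque through `p` tangent to `ℝ^k × 0`, with first coordinate having
  -- identity derivative at the origin.
  obtain ⟨L, hL⟩ := exists_equiv_straightening
    (B := (fderiv ℝ (fun x => ec (W.box p (x, 0))) 0).toLinearMap) hD0
  let pr : EuclideanSpace ℝ (Fin n) →L[ℝ] EuclideanSpace ℝ (Fin k) :=
    (ContinuousLinearMap.fst ℝ _ _).comp L.toContinuousLinearMap
  set Φ : EuclideanSpace ℝ (Fin k) × EuclideanSpace ℝ (Fin (n - k)) →
    EuclideanSpace ℝ (Fin k) × EuclideanSpace ℝ (Fin (n - k)) :=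
      fun z => chartCoord p L (W.box p z) with hΦ
  have hΦ0 : Φ (0, 0) = (0, 0) := by simp only [hΦ, h00, chartCoord_self, Prod.zero_eq_mk]
  have hΦc : ContinuousOn Φ O :=
    continuousOn_chartCoord.comp (W.continuous_box p).continuousOn fun z hz => hz
  have hP : ∀ z ∈ O, HasFDerivAt (fun x => (Φ (x, z.2)).1)
      (pr.comp (fderiv ℝ (fun x => ec (W.box p (x, z.2))) z.1)) z.1 := fun z hz =>
    pr.hasFDerivAt.comp z.1 ((W.differentiableAt_extChartAt_box hz).hasFDerivAt.sub_const (ec p))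
  obtain ⟨ε, hε, hεO, hεinj, hεapp⟩ := exists_ball_approximatesLinearOn_id
    (P := fun z => (Φ z).1) hOo hO0
    (continuousOn_const.clm_comp W.continuousOn_fderiv_extChartAt_box) hP (by
      ext1 w
      exact congrArg Prod.fst (hL w))
  have hinj : ∀ y ∈ Metric.ball (0 : EuclideanSpace ℝ (Fin (n - k))) ε,
      InjOn (fun x : EuclideanSpace ℝ (Fin k) => (chartCoord p L (W.box p (x, y))).1)
        (Metric.ball 0 ε) := fun y hy => (hεapp y hy).injOn_id
  obtain ⟨U, hU, hUac⟩ := hac p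
  -- choice of the size `δ` of the transverse disks
  have hσ : ContinuousAt (chartCoordInv p L) (0, 0) :=
    continuousOn_chartCoordInv.continuousAt
      (isOpen_chartCoordTarget.mem_nhds zero_mem_chartCoordTarget)
  have hσ0 : chartCoordInv p L (0, 0) = p := chartCoordInv_zero
  have hbox : W.box p '' (Metric.ball 0 ε ×ˢ Metric.ball 0 ε) ∈ 𝓝 p := by
    refine ((W.isOpenEmbedding_box p).isOpenMap _
      (Metric.isOpen_ball.prod Metric.isOpen_ball)).mem_nhds ?_
    exact ⟨(0, 0), ⟨Metric.mem_ball_self hε, Metric.mem_ball_self hε⟩, h00⟩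
  obtain ⟨δ, hδ, hδball⟩ := Metric.mem_nhds_iff.1
    (((isOpen_chartCoordTarget (L := L)).eventually_mem (zero_mem_chartCoordTarget (p := p))).and
      (hσ.eventually_mem (by rw [hσ0]; exact inter_mem hU hbox)))
  rw [← ball_prod_same] at hδball
  have hT : ∀ z ∈ Metric.ball (0 : EuclideanSpace ℝ (Fin k)) δ ×ˢ
      Metric.ball (0 : EuclideanSpace ℝ (Fin (n - k))) δ, z ∈ chartCoordTarget p L ∧
      chartCoordInv p L z ∈ W.box p '' (Metric.ball 0 ε ×ˢ Metric.ball 0 ε) :=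
    fun z hz => ⟨(hδball hz).1, (hδball hz).2.2⟩
  have hdisk : ∀ u ∈ Metric.ball (0 : EuclideanSpace ℝ (Fin k)) δ,
      W.IsTransverseDisk p (fun t => chartCoordInv p L (u, δ • t)) := fun u hu =>
    W.isTransverseDisk_chartCoordInv hδ hinj hεinj hT hu
  have hdiskU : ∀ u ∈ Metric.ball (0 : EuclideanSpace ℝ (Fin k)) δ,
      MapsTo (fun t => chartCoordInv p L (u, δ • t))
        (Metric.ball (0 : EuclideanSpace ℝ (Fin (n - k))) 1) U := by
    intro u hu t ht
    refine (hδball (show (u, δ • t) ∈ _ from ⟨hu, ?_⟩)).2.1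
    change δ • t ∈ Metric.ball (0 : EuclideanSpace ℝ (Fin (n - k))) δ
    rw [mem_ball_zero_iff] at ht ⊢
    rw [norm_smul, Real.norm_eq_abs, abs_of_pos hδ]
    exact mul_lt_of_lt_one_right hδ ht
  -- choice of the size of the box
  have hΦc0 : ContinuousAt Φ (0, 0) := hΦc.continuousAt (hOo.mem_nhds hO0)
  obtain ⟨η, hη, hηball⟩ := Metric.mem_nhds_iff.1
    (hΦc0 (show Metric.ball 0 δ ×ˢ Metric.ball 0 δ ∈ 𝓝 (Φ (0, 0)) by
      rw [hΦ0, ← Prod.zero_eq_mk, ball_prod_same]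
      exact Metric.ball_mem_nhds _ hδ))
  rw [← Prod.zero_eq_mk, ← ball_prod_same] at hηball
  set r := min η ε / 2 with hr
  have hr0 : 0 < r := by positivity
  have hrε : r < ε := by
    have := min_le_right η ε
    linarith
  have hrη : r < η := by
    have := min_le_left η ε
    linarith
  have hcy : ContinuousAt (fun y => (Φ (0, y)).1) (0 : EuclideanSpace ℝ (Fin (n - k))) :=
    continuous_fst.continuousAt.comp (ContinuousAt.comp (f := fun y => ((0 : EuclideanSpace ℝ (Fin k)), y))
      hΦc0 (by fun_prop))
  -- For such `y` the origin is within `r / 2` of `(Φ (0, y)).1`, so `surjOn_closedBall_id` yields a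
  -- point of the plaque on the central vertical disk.
  obtain ⟨ε₁, hε₁, hε₁ball⟩ := Metric.mem_nhds_iff.1
    (hcy (show Metric.ball 0 (r / 2) ∈ 𝓝 (Φ (0, 0)).1 by
      rw [hΦ0]
      exact Metric.ball_mem_nhds _ (by positivity)))
  set ε' := min ε₁ (min η ε) with hε'
  have hε'0 : 0 < ε' := by positivity
  have hε'ε : ε' ≤ ε := (min_le_right _ _).trans (min_le_right _ _)
  have hε'η : ε' ≤ η := (min_le_right _ _).trans (min_le_left _ _)
  set Q : Set (EuclideanSpace ℝ (Fin k) × EuclideanSpace ℝ (Fin (n - k))) :=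
    (Metric.ball 0 ε ×ˢ Metric.ball 0 ε') ∩ Φ ⁻¹' (Metric.ball 0 δ ×ˢ Metric.ball 0 δ) with hQ
  have hQ0 : Q ∈ 𝓝 (0, 0) := by
    refine inter_mem ((Metric.isOpen_ball.prod Metric.isOpen_ball).mem_nhds
      ⟨Metric.mem_ball_self hε, Metric.mem_ball_self hε'0⟩) (hΦc0 ?_)
    rw [hΦ0, ← Prod.zero_eq_mk, ball_prod_same]
    exact Metric.ball_mem_nhds _ hδ
  refine ⟨W.box p '' Q, ?_, fun A hAV hAm hA0 => ?_⟩
  · have h1 := (W.isOpenEmbedding_box p).isOpenMap.image_mem_nhds hQ0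
    rwa [h00] at h1
  have hAQ : ∀ z, W.box p z ∈ A → z ∈ Q := by
    intro z hz
    obtain ⟨z', hz', he⟩ := hAV hz
    exact W.injective_box p he ▸ hz'
  have hinvΦ : ∀ z ∈ Metric.ball (0 : EuclideanSpace ℝ (Fin k)) ε ×ˢ
      Metric.ball (0 : EuclideanSpace ℝ (Fin (n - k))) ε,
      chartCoordInv p L (Φ z) = W.box p z := fun z hz => chartCoordInv_chartCoord (hεO hz)
  -- The label of the plaque through the point at height `s` of the central vertical disk.
  set κ : EuclideanSpace ℝ (Fin (n - k)) → EuclideanSpace ℝ (Fin (n - k)) := fun s =>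
    ((W.boxHomeo p).symm (chartCoordInv p L (0, s))).2 with hκ
  have hδ0 : ∀ s ∈ Metric.ball (0 : EuclideanSpace ℝ (Fin (n - k))) δ,
      ((0 : EuclideanSpace ℝ (Fin k)), s) ∈ Metric.ball (0 : EuclideanSpace ℝ (Fin k)) δ ×ˢ
      Metric.ball (0 : EuclideanSpace ℝ (Fin (n - k))) δ :=
    fun s hs => ⟨Metric.mem_ball_self hδ, hs⟩
  have hκbox : ∀ s ∈ Metric.ball (0 : EuclideanSpace ℝ (Fin (n - k))) δ,
      κ s ∈ Metric.ball 0 ε ∧ ∃ x, W.box p (x, κ s) = chartCoordInv p L (0, s) := by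
    intro s hs
    obtain ⟨z, hz, he⟩ := (hT _ (hδ0 s hs)).2
    have h1 : κ s = z.2 := by simp only [hκ, ← he, W.boxHomeo_symm_box]
    rw [h1]
    exact ⟨hz.2, z.1, he⟩
  have himage : volume (Φ '' (W.box p ⁻¹' A)) = 0 := by
    refine measure_image_eq_zero_of_holonomy (ε := ε) (δ := δ) (κ := κ) (hΦc.mono hεO) ?_ ?_ hinj
      ?_ (fun s hs => (hκbox s hs).1) ?_ ((W.continuous_box p).measurable hAm) ?_ ?_ ?_
      (fun y _ => hA0 y)
    · intro z hz z' hz' h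
      rw [← W.injective_box p |>.eq_iff, ← hinvΦ z hz, ← hinvΦ z' hz', h]
    · exact fun y hy x hx => (hP (x, y) (hεO ⟨hx, hy⟩)).differentiableAt.differentiableWithinAt
    · have h1 : ContinuousOn (fun s => chartCoordInv p L ((0 : EuclideanSpace ℝ (Fin k)), s))
          (Metric.ball 0 δ) :=
        continuousOn_chartCoordInv.comp (by fun_prop) fun s hs => (hT _ (hδ0 s hs)).1
      exact continuous_snd.comp_continuousOn ((W.continuousOn_boxHomeo_symm p).comp h1
        fun s hs => image_subset_range _ _ (hT _ (hδ0 s hs)).2)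
    · intro u hu N hN hN0
      -- Transverse disks are parametrized by the unit ball, hence the rescaling by `δ` here and
      -- back below.
      have hN1 : volume ((fun s => δ • s) ⁻¹' N) = 0 := by
        rw [Measure.addHaar_preimage_smul _ hδ.ne', hN0, mul_zero]
      have hN1' : (fun s => δ • s) ⁻¹' N ⊆ Metric.ball 0 1 := by
        intro s hs
        have h1 := hN hs
        rw [mem_ball_zero_iff, norm_smul, Real.norm_eq_abs, abs_of_pos hδ] at h1
        rw [mem_ball_zero_iff]
        by_contra h2
        exact absurd h1 (not_lt.2 (le_mul_of_one_le_right hδ.le (not_lt.1 h2)))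
      have h2 := hUac _ _ (hdisk 0 (Metric.mem_ball_self hδ)) (hdisk u hu)
        (hdiskU 0 (Metric.mem_ball_self hδ)) (hdiskU u hu) _ hN1' hN1
      have h3 : volume ((fun s => δ⁻¹ • s) ⁻¹' {t ∈ Metric.ball (0 : EuclideanSpace ℝ (Fin (n - k))) 1 |
          ∃ s ∈ (fun s => δ • s) ⁻¹' N, W.SamePlaqueIn p (chartCoordInv p L (0, δ • s))
            (chartCoordInv p L (u, δ • t))}) = 0 := by
        rw [Measure.addHaar_preimage_smul _ (inv_ne_zero hδ.ne'), h2, mul_zero]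
      refine measure_mono_null ?_ h3
      rintro t ⟨ht, s, hs, x, hx, he⟩
      refine ⟨?_, δ⁻¹ • s, ?_, ?_⟩
      · rw [mem_ball_zero_iff] at ht ⊢
        rw [norm_smul, norm_inv, Real.norm_eq_abs, abs_of_pos hδ, inv_mul_lt_iff₀ hδ, mul_one]
        exact ht
      · rw [mem_preimage, smul_inv_smul₀ hδ.ne']
        exact hs
      · simp only [smul_inv_smul₀ hδ.ne']
        obtain ⟨hκε, x', hx'⟩ := hκbox s (hN hs)
        have h5 := hinvΦ (x, κ s) (mk_mem_prod hx hκε)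
        rw [he] at h5
        exact ⟨x', x, κ s, hx', h5.symm⟩
    · exact fun z hz => ⟨(hAQ z hz).1.1, Metric.ball_subset_ball hε'ε (hAQ z hz).1.2⟩
    · exact fun z hz => (hAQ z hz).2
    · rintro ⟨x, y⟩ hz
      have hy : y ∈ Metric.ball 0 ε' := (hAQ _ hz).1.2
      have hyε : y ∈ Metric.ball 0 ε := Metric.ball_subset_ball hε'ε hy
      have hsurj := (hεapp y hyε).surjOn_closedBall_id hr0.le hrε
      have h1 : (0 : EuclideanSpace ℝ (Fin k)) ∈ Metric.closedBall (Φ (0, y)).1 (r / 2) := by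
        rw [Metric.mem_closedBall, dist_comm]
        exact (hε₁ball (Metric.ball_subset_ball (min_le_left _ _) hy)).le
      obtain ⟨x', hx', he⟩ := hsurj h1
      have hxε : x' ∈ Metric.ball 0 ε := Metric.closedBall_subset_ball hrε hx'
      have hin : Φ (x', y) ∈ Metric.ball 0 δ ×ˢ Metric.ball 0 δ :=
        hηball ⟨Metric.closedBall_subset_ball hrη hx', Metric.ball_subset_ball hε'η hy⟩
      refine ⟨(Φ (x', y)).2, hin.2, ?_⟩
      have h2 : ((0 : EuclideanSpace ℝ (Fin k)), (Φ (x', y)).2) = Φ (x', y) :=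
        Prod.ext he.symm rfl
      simp only [hκ]
      rw [h2, hinvΦ (x', y) (mk_mem_prod hxε hyε), W.boxHomeo_symm_box]
  have hAsrc : A ⊆ ec.source := by
    intro a ha
    obtain ⟨z, hz, rfl⟩ := hAV ha
    exact hεO ⟨hz.1.1, Metric.ball_subset_ball hε'ε hz.1.2⟩
  refine hμ.measure_eq_zero (chart_mem_atlas _ p) (by rwa [hec, extChartAt_source] at hAsrc) hAm ?_
  have hprod : (volume : Measure (EuclideanSpace ℝ (Fin k) ×
      EuclideanSpace ℝ (Fin (n - k)))).IsAddHaarMeasure :=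
    inferInstanceAs (Measure.IsAddHaarMeasure (Measure.prod volume volume))
  refine measure_mono_null ?_ (addHaar_preimage_equiv_sub_eq_zero L (ec p) himage)
  rintro _ ⟨a, ha, rfl⟩
  obtain ⟨z, hz, rfl⟩ := hAV ha
  exact ⟨z, ha, rfl⟩

/-- For an absolutely continuous foliation, a set which meets every plaque in a null set is a null
set. -/
theorem IsAbsolutelyContinuous.measure_eq_zero (hac : W.IsAbsolutelyContinuous)
    {μ : Measure M} (hμ : IsSmoothVolume n μ) {A : Set M} (hA : MeasurableSet A)
    (hA0 : ∀ p y, volume {x | W.box p (x, y) ∈ A} = 0) : μ A = 0 := by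
  choose V hV hVA using fun p => hac.exists_nhds_measure_eq_zero hμ p
  obtain ⟨t, ht⟩ := CompactSpace.elim_nhds_subcover (fun p => interior (V p))
    fun p => interior_mem_nhds.2 (hV p)
  have h1 : A ⊆ ⋃ p ∈ t, A ∩ interior (V p) := by
    rw [← inter_iUnion₂, ht]
    exact fun a ha => ⟨ha, mem_univ a⟩
  refine measure_mono_null h1 ((measure_biUnion_null_iff t.countable_toSet).2 fun p _ => ?_)
  refine hVA p _ (inter_subset_right.trans interior_subset)
    (hA.inter isOpen_interior.measurableSet) fun y => ?_
  exact measure_mono_null (fun x hx => hx.1) (hA0 p y)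

end Foliation

/-! ### Jacobians of iterates and volume growth -/

namespace Foliation

variable {n k : ℕ} {M : Type*} [TopologicalSpace M]
  [ChartedSpace (EuclideanSpace ℝ (Fin n)) M]

lemma contMDiff_iterate {f : M → M} (hf : ContMDiff (𝓡 n) (𝓡 n) 1 f) (i : ℕ) :
    ContMDiff (𝓡 n) (𝓡 n) 1 f^[i] := by
  induction i with
  | zero => exact contMDiff_id
  | succ i ih => exact ih.comp hf

variable [IsManifold (𝓡 n) ∞ M] (W : Foliation n k M)

lemma IsInvariant.iterate {W : Foliation n k M} {f : M → M} (h : W.IsInvariant f) (i : ℕ) :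
    W.IsInvariant f^[i] := by
  induction i with
  | zero => intro x; simp
  | succ i ih =>
    intro x
    rw [Function.iterate_succ, image_comp, h, ih, Function.comp_apply]

variable [CompactSpace M] [RiemannianBundle (fun x : M => TangentSpace (𝓡 n) x)]

/-- By the chain rule this positive number equals its own square. -/
lemma leafJacobian_id (x : M) : W.leafJacobian id x = 1 := by
  have h1 := W.leafJacobian_comp (g := id) (h := id) contMDiff_id contMDiff_id
    (fun a => by simp) x
  have h2 : 0 < W.leafJacobian id x := W.leafJacobian_pos (by
    rw [mfderiv_id]
    exact Function.injective_id)
  simp only [Function.id_comp, id_eq] at h1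
  exact (mul_eq_left₀ h2.ne').1 h1.symm

/-- The logarithm of the leafwise Jacobian of the iterates is a Birkhoff sum. -/
lemma leafJacobian_iterate {f : M → M} (hf : ContMDiff (𝓡 n) (𝓡 n) 1 f)
    (hW : ∀ a, f '' W.leaf a ⊆ W.leaf (f a)) (hpos : ∀ x, 0 < W.leafJacobian f x) (j : ℕ)
    (x : M) : 0 < W.leafJacobian f^[j] x ∧ Real.log (W.leafJacobian f^[j] x) =
      birkhoffSum f (fun x => Real.log (W.leafJacobian f x)) j x := by
  induction j generalizing x with
  | zero => simp [leafJacobian_id]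
  | succ j ih =>
    rw [Function.iterate_succ, W.leafJacobian_comp (contMDiff_iterate hf j) hf hW,
      birkhoffSum_succ', Real.log_mul (ih (f x)).1.ne' (hpos x).ne', (ih (f x)).2]
    exact ⟨mul_pos (ih (f x)).1 (hpos x), add_comm _ _⟩

variable [IsContMDiffRiemannianBundle (𝓡 n) ∞ (EuclideanSpace ℝ (Fin n))
      (fun x : M => TangentSpace (𝓡 n) x)] {W}

/-- If the leafwise Jacobians of the iterates grow at an exponential rate larger than `b` on a set
of positive volume in some plaque, then the volume growth is at least `b`. -/
lemma le_maxVolumeGrowth {f : M → M} (hf : ContMDiff (𝓡 n) (𝓡 n) 1 f)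
    (hinj : Function.Injective f) (hW : W.IsInvariant f) {a b ρ : ℝ} (hab : b < a) (hρ : 0 < ρ)
    {N : ℕ} {p : M} {y : EuclideanSpace ℝ (Fin (n - k))} {S : Set (EuclideanSpace ℝ (Fin k))}
    (hSm : MeasurableSet S) (hS : volume S ≠ 0)
    (hSJ : ∀ x ∈ S, ∀ j ≥ N, Real.exp (a * j) ≤ W.leafJacobian f^[j] (W.box p (x, y))) :
    (b : EReal) ≤ W.maxVolumeGrowth f ρ := by
  -- Every neighbourhood of `x₀` meets `S` in positive measure, so the disk about `x₀` may be as
  -- small as `ρ` requires.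
  obtain ⟨x₀, -, hx₀⟩ := exists_mem_forall_mem_nhdsWithin_pos_measure hS
  obtain ⟨δ, hδ, hball⟩ := W.exists_ball_subset_leafDisk p x₀ y hρ
  set E := S ∩ Metric.ball x₀ δ with hE
  have hEpos : 0 < volume E :=
    hx₀ _ (inter_mem self_mem_nhdsWithin (mem_nhdsWithin_of_mem_nhds (Metric.ball_mem_nhds _ hδ)))
  have hEm : MeasurableSet E := hSm.inter measurableSet_ball
  have hcont : Continuous fun x => volDensity (n := n) (fun u => W.box p (u, y)) x :=
    continuous_volDensity (n := n) (F := fun _ u => W.box p (u, y)) (u := id) fun w =>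
      (W.continuous_mfderiv_plaque p w).comp (f := fun z => (z, y)) (by fun_prop)
  set c := ∫⁻ x in E, ENNReal.ofReal (volDensity (n := n) (fun u => W.box p (u, y)) x) with hc
  have hc0 : 0 < c := by
    rw [hc, setLIntegral_pos_iff hcont.measurable.ennreal_ofReal]
    refine hEpos.trans_le (measure_mono fun x hx => ⟨?_, hx⟩)
    exact (ENNReal.ofReal_pos.2 (W.volDensity_box_pos p x y)).ne'
  have hvol : ∀ j ≥ N, ENNReal.ofReal (Real.exp (a * j)) * c ≤
      W.leafVolume (f^[j] '' W.leafDisk (W.box p (x₀, y)) ρ) := by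
    intro j hj
    refine le_trans ?_ (W.setLIntegral_volDensity_le_leafVolume (contMDiff_iterate hf j)
      (hinj.iterate j) (fun a => (hW.iterate j a).subset) p y (E := E) ?_)
    · rw [hc, ← lintegral_const_mul _ hcont.measurable.ennreal_ofReal]
      refine setLIntegral_mono' hEm fun x hx => ?_
      rw [W.volDensity_comp_box ((contMDiff_iterate hf j).mdifferentiable one_ne_zero _),
        ← ENNReal.ofReal_mul (Real.exp_pos _).le]
      exact ENNReal.ofReal_le_ofReal (mul_le_mul_of_nonneg_right (hSJ x hx.1 j hj)
        (volDensity_nonneg _ _))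
    · exact fun x hx => mem_image_of_mem _ (hball x hx.2)
  -- A real lower bound for `log c`, which might be infinite; the gap `a - b` eventually absorbs it.
  obtain ⟨d, -, hd⟩ := EReal.lt_iff_exists_real_btwn.1 (ENNReal.bot_lt_log_iff.2 hc0)
  refine le_trans ?_ (le_iSup (fun x => W.volumeGrowthAt f x ρ) (W.box p (x₀, y)))
  refine le_limsup_of_frequently_le (Eventually.frequently ?_)
  have htend : Tendsto (fun j : ℕ => (a - b) * (j : ℝ) + d) atTop atTop :=
    tendsto_atTop_add_const_right _ _
      (tendsto_natCast_atTop_atTop.const_mul_atTop (sub_pos.2 hab))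
  filter_upwards [htend.eventually_ge_atTop 0, eventually_ge_atTop N, eventually_gt_atTop 0]
    with j h1 h2 h3
  rw [EReal.le_div_iff_mul_le (by exact_mod_cast h3) (EReal.natCast_ne_top j)]
  calc (b : EReal) * (j : EReal) = ((b * j : ℝ) : EReal) := by
        rw [EReal.coe_mul, EReal.coe_natCast]
    _ ≤ ((a * j + d : ℝ) : EReal) := by
        rw [EReal.coe_le_coe_iff]
        linarith
    _ = ((a * j : ℝ) : EReal) + d := EReal.coe_add _ _
    _ ≤ ENNReal.log (ENNReal.ofReal (Real.exp (a * j))) + ENNReal.log c := by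
        refine add_le_add ?_ hd.le
        rw [ENNReal.log_ofReal_of_pos (Real.exp_pos _), Real.log_exp]
    _ = ENNReal.log (ENNReal.ofReal (Real.exp (a * j)) * c) := ENNReal.log_mul_add.symm
    _ ≤ _ := ENNReal.log_le_log (hvol j h2)

end Foliation

/-! ### The main theorem -/

theorem mainTheorem6 {n k : ℕ} (hk : k ≤ n)
    {M : Type*} [TopologicalSpace M] [T2Space M] [CompactSpace M]
    [ChartedSpace (EuclideanSpace ℝ (Fin n)) M] [IsManifold (𝓡 n) ∞ M]
    [RiemannianBundle (fun x : M => TangentSpace (𝓡 n) x)]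
    [IsContMDiffRiemannianBundle (𝓡 n) ∞ (EuclideanSpace ℝ (Fin n))
      (fun x : M => TangentSpace (𝓡 n) x)]
    [MeasurableSpace M] [BorelSpace M]
    (μ : Measure M) [IsProbabilityMeasure μ] (hμ : IsSmoothVolume n μ)
    (r : ℕ∞) (hr : 1 ≤ r) (f : M ≃ₘ^r⟮𝓡 n, 𝓡 n⟯ M) (hf : MeasurePreserving f μ μ)
    (W : Foliation n k M) (hW : W.IsInvariant f) (hac : W.IsAbsolutelyContinuous) :
    (∀ᵐ x ∂μ, Tendsto (fun j : ℕ => Real.log (W.leafJacobian f^[j] x) / j) atTop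
      (𝓝 (W.lyapunovExponent f x))) ∧
    Integrable (W.lyapunovExponent f) μ ∧
    Integrable (fun x => Real.log (W.leafJacobian f x)) μ ∧
    W.integratedLyapunovExponent f μ = ∫ x, Real.log (W.leafJacobian f x) ∂μ ∧
    ∀ ρ : ℝ, 0 < ρ →
      (W.integratedLyapunovExponent f μ : EReal) ≤ W.maxVolumeGrowth f ρ := by
  have hf1 : ContMDiff (𝓡 n) (𝓡 n) 1 f := f.contMDiff.of_le (by exact_mod_cast hr)
  have hsub : ∀ a, f '' W.leaf a ⊆ W.leaf (f a) := fun a => (hW a).subset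
  have hpos : ∀ x, 0 < W.leafJacobian f x := fun x => W.leafJacobian_pos
    (f.mfderivToContinuousLinearEquiv (by
      have : (1 : WithTop ℕ∞) ≤ r := by exact_mod_cast hr
      exact (zero_lt_one.trans_le this).ne') x).injective
  set φ : M → ℝ := fun x => Real.log (W.leafJacobian f x) with hφ
  have hφc : Continuous φ := (W.continuous_leafJacobian hf1).log fun x => (hpos x).ne'
  obtain ⟨C, hC⟩ := isCompact_univ.exists_bound_of_continuousOn hφc.continuousOn
  have hC' : ∀ x, |φ x| ≤ C := fun x => hC x (mem_univ x)
  have hJ := W.leafJacobian_iterate hf1 hsub hpos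
  have havg : ∀ (j : ℕ) x, Real.log (W.leafJacobian f^[j] x) / j = birkhoffAverage ℝ f φ j x := by
    intro j x
    rw [(hJ j x).2, birkhoffAverage, smul_eq_mul, div_eq_inv_mul]
  obtain ⟨hlim, hint, heq⟩ := ae_tendsto_birkhoffAverage hf hφc.measurable hC'
  -- `limUnder` is meaningful only where the limit exists, so measurability and the integral are
  -- inherited from the upper average almost everywhere.
  have hlyap : W.lyapunovExponent f =ᵐ[μ] upperBirkhoffAverage f φ := by
    filter_upwards [hlim] with x hx
    refine Tendsto.limUnder_eq ?_
    simp only [havg]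
    exact hx
  have hconv : ∀ᵐ x ∂μ, Tendsto (fun j : ℕ => Real.log (W.leafJacobian f^[j] x) / j) atTop
      (𝓝 (W.lyapunovExponent f x)) := by
    filter_upwards [hlim, hlyap] with x hx hx'
    simp only [havg, hx']
    exact hx
  have hlint : Integrable (W.lyapunovExponent f) μ := hint.congr hlyap.symm
  refine ⟨hconv, hlint, integrable_of_abs_le hφc.measurable hC',
    (integral_congr_ae hlyap).trans heq, fun ρ hρ => ?_⟩
  by_contra! hlt
  obtain ⟨a, ha, haΛ⟩ := EReal.lt_iff_exists_real_btwn.1 hlt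
  obtain ⟨b, hb, hba⟩ := EReal.lt_iff_exists_real_btwn.1 ha
  have hba' : b < a := EReal.coe_lt_coe_iff.1 hba
  set A : ℕ → Set M := fun N => {x | ∀ j ≥ N, Real.exp (a * j) ≤ W.leafJacobian f^[j] x} with hA
  have hAm : ∀ N, MeasurableSet (A N) := fun N => by
    refine IsClosed.measurableSet ?_
    simp only [hA, ofPred_forall]
    exact isClosed_iInter fun j => isClosed_iInter fun _ => isClosed_le continuous_const
      (W.continuous_leafJacobian (Foliation.contMDiff_iterate hf1 j))
  -- Any point whose exponent exceeds `a` lies in some `A N`; if all were null, the integrated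
  -- exponent would be at most `a`.
  have hex : ∃ N, μ (A N) ≠ 0 := by
    by_contra! h0
    have h1 : ∀ᵐ x ∂μ, W.lyapunovExponent f x ≤ a := by
      have h2 : ∀ᵐ x ∂μ, x ∉ ⋃ N, A N := measure_eq_zero_iff_ae_notMem.1 (measure_iUnion_null h0)
      filter_upwards [hconv, h2] with x hx hx'
      by_contra! hax
      obtain ⟨N, hN⟩ := eventually_atTop.1
        ((hx.eventually_const_lt hax).and (eventually_gt_atTop 0))
      refine hx' (mem_iUnion.2 ⟨N, fun j hj => ?_⟩)
      have h3 : (0 : ℝ) < j := by exact_mod_cast (hN j hj).2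
      rw [← Real.le_log_iff_exp_le (hJ j x).1]
      exact ((lt_div_iff₀ h3).1 (hN j hj).1).le
    have h4 : ∫ x, W.lyapunovExponent f x ∂μ ≤ ∫ _, a ∂μ :=
      integral_mono_ae hlint (integrable_const a) h1
    rw [integral_const, probReal_univ, one_smul] at h4
    exact absurd (EReal.coe_lt_coe_iff.1 haΛ) (not_lt.2 h4)
  obtain ⟨N, hN⟩ := hex
  have hplaque : ∃ p y, volume {x | W.box p (x, y) ∈ A N} ≠ 0 := by
    by_contra! h0
    exact hN (hac.measure_eq_zero hμ (hAm N) h0)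
  obtain ⟨p, y, hpy⟩ := hplaque
  exact absurd hb (not_lt.2 (Foliation.le_maxVolumeGrowth hf1 f.injective hW hba' hρ
    ((W.continuous_plaque p y).measurable (hAm N)) hpy fun x hx j hj => hx j hj))
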